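/- \textbf{Setting.} Let $T=[t_0,t_f]$ with $t_0<t_f$, let $p\ge 2$ be an even integer, and let $Y=\{y\in\mathbb R^n:\ g^Y_j(y)\ge 0,\ j=1,\dots,n_Y\}$ be a basic semialgebraic set (automatically compact under the hypotheses on $G$ below). Let $l\in\mathbb R[t,y,u]$ and $f\in\mathbb R[t,y,u]^n$ have degree at most $p$ in $u\in\mathbb R^m$, and assume that $l$ is coercive: for some $\delta>0$, $l(t,y,u)\ge\delta|u|^p$ for all $(t,y,u)\in T\times Y\times\mathbb R^m$, where $|u|^p=\sum_{j=1}^m|u_j|^p$. Boundary values $y(t_0)$ and $y(t_f)$ in $\mathbb R^n$ are prescribed. Let $\hat l,\hat f$ be the homogenizations of $l,f$ with respect to the control: each monomial $t^a y^b u^c$ is replaced by $t^a y^b w^c w_0^{p-|c|}$. Let $$W=\Big\{(w_0,w)\in[0,1]\times B^m:\ w_0^p=1-\sum_{j=1}^m w_j^p\Big\},\qquad G=T\times Y\times W\subset\mathbb R^{1+n+1+m},$$ where $B^m$ is the unit ball of the $p$-norm. Let $g_1,\dots,g_{n_G}$ be polynomials in $x=(t,y,w_0,w)$ such that $G=\{x:\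 g_i(x)\ge 0,\ i=1,\dots,n_G\}$ and such that one of them is $r-\|x\|_2^2$ for some $r\in\mathbb R$; put $g_0=1$. \textbf{Measure LP.} Let $p_W^*$ be the infimum of $\int\hat l\,d\gamma$ over all finite positive Borel measures $\gamma$ supported on $G$ such that, for all $v\in C^1(T\times Y)$ (restrictions of $C^1$ functions on $\mathbb R^{1+n}$), $$\int\Big(\frac{\partial v}{\partial t}w_0^p+\frac{\partial v}{\partial y}\hat f\Big)d\gamma=v(t_f,y(t_f))-v(t_0,y(t_0)).$$ \textbf{Moment problem.} For a real sequence $z=(z_\beta)_{\beta\in\mathbb N^{1+n+1+m}}$ let $\ell_z$ be the linear functional on polynomials with $\ell_z(x^\beta)=z_\beta$, and for a polynomial $g$ let $M_k(g\,z)$ be the matrix with entries $\ell_z(g\,x^{\alpha+\beta})$, $|\alpha|,|\beta|\le k$. For $\alpha\in\mathbb N^{1+n}$ let $v_\alpha(t,y)=(t,y)^\alpha$ and $A_\alpha=\frac{\partial v_\alpha}{\partial t}w_0^p+\frac{\partial v_\alpha}{\partial y}\hat f$. Let $p_\infty^*$ be the infimum of $\ell_z(\hat l)$ over all sequences $z$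 with $\ell_z(A_\alpha)=v_\alpha(t_f,y(t_f))-v_\alpha(t_0,y(t_0))$ for all $\alpha\in\mathbb N^{1+n}$ and $M_k(g_i\,z)\succeq0$ for all $k\in\mathbb N$ and $i=0,\dots,n_G$. \textbf{Relaxations.} Let $d_0$ be the smallest integer such that $\hat l$, $w_0^p$, the components of $\hat f$ and all $g_i$ have total degree at most $2d_0$. For $d\ge d_0$ let $p_d^*$ be the infimum of $\ell_z(\hat l)$ over all finite vectors $z=(z_\beta)_{|\beta|\le 2d}$ with $\ell_z(A_\alpha)=v_\alpha(t_f,y(t_f))-v_\alpha(t_0,y(t_0))$ for all $\alpha$ with $\deg A_\alpha\le 2d$, and $M_{d-\lceil\deg g_i/2\rceil}(g_i\,z)\succeq 0$ for $i=0,\dots,n_G$. All infima are taken in $[-\infty,+\infty]$, the infimum over the empty set being $+\infty$. \textbf{Theorem.} The values of the relaxations are monotonically non-decreasing and converge to the value of the measure LP: $$p^*_{d_0}\le p^*_{d_0+1}\le\cdots\le p^*_\infty=p_W^*,\qquad \lim_{d\to\infty}p_d^*=p_\infty^*.$$ -/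

import Mathlib

open MeasureTheory Filter Topology MvPolynomial

noncomputable section

namespace MomentOCP

/-- Index set of the variables `(t, y)`: `Sum.inl ()` is `t`, `Sum.inr i` is `y_i`. -/
abbrev TY (n : ℕ) := Unit ⊕ Fin n

/-- Index set of the variables `(t, y, u)`. -/
abbrev TYU (n m : ℕ) := TY n ⊕ Fin m

/-- Index set of the `1 + n + 1 + m` variables `(t, y, w₀, w)`. -/
abbrev TYW (n m : ℕ) := TY n ⊕ (Unit ⊕ Fin m)

/-- The index of the time variable in `(t, y)`. -/
abbrev iT {n : ℕ} : TY n := Sum.inl ()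
/-- The index of the state variable `y_i` in `(t, y)`. -/
abbrev iY {n : ℕ} (i : Fin n) : TY n := Sum.inr i
/-- The index of the lifting variable `w₀` in `(t, y, w₀, w)`. -/
abbrev iW0 {n m : ℕ} : TYW n m := Sum.inr (Sum.inl ())
/-- The index of the variable `w_j` in `(t, y, w₀, w)`. -/
abbrev iW {n m : ℕ} (j : Fin m) : TYW n m := Sum.inr (Sum.inr j)

/-- The point `(t, y)` of `ℝ^{1+n}`. -/
def pointTY {n : ℕ} (t : ℝ) (y : Fin n → ℝ) : TY n → ℝ := Sum.elim (fun _ => t) y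

/-- The point `(t, y, u)` of `ℝ^{1+n+m}`. -/
def pointTYU {n m : ℕ} (t : ℝ) (y : Fin n → ℝ) (u : Fin m → ℝ) : TYU n m → ℝ :=
  Sum.elim (pointTY t y) u

/-- The data of a polynomial optimal control problem
`min ∫ l(t,y,u) dt`, `ẏ = f(t,y,u)`, `y(t₀) = y₀`, `y(t_f) = y_f`, `y(t) ∈ Y`, `u ∈ L^p`,
with `Y = {y | gY_j(y) ≥ 0, j = 1..nY}`. -/
structure PolyOCP (n m : ℕ) where
  t0 : ℝ
  tf : ℝ
  y0 : Fin n → ℝ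
  yf : Fin n → ℝ
  p : ℕ
  l : MvPolynomial (TYU n m) ℝ
  f : Fin n → MvPolynomial (TYU n m) ℝ
  nY : ℕ
  gY : Fin nY → MvPolynomial (Fin n) ℝ

/-- Every monomial of `q` has degree at most `p` in the control variables `u`. -/
def CtrlDegreeLE {n m : ℕ} (p : ℕ) (q : MvPolynomial (TYU n m) ℝ) : Prop :=
  ∀ α ∈ q.support, ∑ j : Fin m, α (Sum.inr j) ≤ p

/-- Homogenization by `w₀` with respect to the control: each monomial `t^a y^b u^c` of `q` becomes
`t^a y^b w^c w₀^{p - |c|}` (meaningful when `CtrlDegreeLE p q`). -/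
def homogenize {n m : ℕ} (p : ℕ) (q : MvPolynomial (TYU n m) ℝ) : MvPolynomial (TYW n m) ℝ :=
  ∑ α ∈ q.support,
    C (q.coeff α) * (∏ s : TY n, X (Sum.inl s) ^ α (Sum.inl s)) *
      X iW0 ^ (p - ∑ j : Fin m, α (Sum.inr j)) * (∏ j : Fin m, X (iW j) ^ α (Sum.inr j))

/-! ### Moment sequences and localizing matrices -/

/-- The linear functional `ℓ_z : ∑ q_α x^α ↦ ∑ q_α z_α`. -/
def riesz {σ : Type*} (z : (σ →₀ ℕ) → ℝ) (q : MvPolynomial σ ℝ) : ℝ :=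
  ∑ α ∈ q.support, q.coeff α * z α

/-- The multi-indices of degree at most `d`. -/
abbrev MultiIdx (σ : Type*) (d : ℕ) := {α : σ →₀ ℕ // α.degree ≤ d}

/-- The localizing matrix `M_d(g z)`, with entries `ℓ_z(g x^{α+β})`, `|α|, |β| ≤ d`. -/
def locMatrix {σ : Type*} (d : ℕ) (g : MvPolynomial σ ℝ) (z : (σ →₀ ℕ) → ℝ) :
    Matrix (MultiIdx σ d) (MultiIdx σ d) ℝ :=
  fun α β => riesz z (g * monomial (α.1 + β.1) 1)

/-- A finite vector of moments of degree at most `k`, padded by zeros. -/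
def padZero {σ : Type*} {k : ℕ} (z : MultiIdx σ k → ℝ) : (σ →₀ ℕ) → ℝ :=
  fun α => if h : α.degree ≤ k then z ⟨α, h⟩ else 0

/-- The half-degree `⌈deg g / 2⌉`. -/
def halfDeg {σ : Type*} (g : MvPolynomial σ ℝ) : ℕ := (g.totalDegree + 1) / 2

namespace PolyOCP

variable {n m : ℕ} (P : PolyOCP n m)

/-- The state constraint set `Y`. -/
def Y : Set (Fin n → ℝ) := {y | ∀ j, 0 ≤ eval y (P.gY j)}

/-- The homogenized cost `l̂`. -/
def lHat : MvPolynomial (TYW n m) ℝ := homogenize P.p P.l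

/-- The homogenized dynamics `f̂`. -/
def fHat (i : Fin n) : MvPolynomial (TYW n m) ℝ := homogenize P.p (P.f i)

/-- The set `W` of lifted controls `(w₀, w)`, in `[0,1] × B^m` with `B^m` the unit ball of the
`p`-norm. -/
def W : Set ((Unit ⊕ Fin m) → ℝ) :=
  {w | w (Sum.inl ()) ∈ Set.Icc (0 : ℝ) 1 ∧ ∑ j : Fin m, |w (Sum.inr j)| ^ P.p ≤ 1 ∧
    w (Sum.inl ()) ^ P.p = 1 - ∑ j : Fin m, w (Sum.inr j) ^ P.p}

/-- The set `G = T × Y × W` in `ℝ^{1+n+1+m}`, with `T = [t₀, t_f]`. -/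
def G : Set (TYW n m → ℝ) :=
  {x | x (Sum.inl iT) ∈ Set.Icc P.t0 P.tf ∧ (fun i => x (Sum.inl (iY i))) ∈ P.Y ∧
    (fun k => x (Sum.inr k)) ∈ P.W}

/-! ### The measure LP -/

/-- The function `∂v/∂t w₀^p + ∂v/∂y f̂` on `ℝ^{1+n+1+m}`, for a differentiable `v(t, y)`. -/
def transport (v : (TY n → ℝ) → ℝ) (x : TYW n m → ℝ) : ℝ :=
  fderiv ℝ v (fun s => x (Sum.inl s)) (Pi.single iT 1) * x iW0 ^ P.p +
    ∑ i : Fin n, fderiv ℝ v (fun s => x (Sum.inl s)) (Pi.single (iY i) 1) * eval x (P.fHat i)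

/-- Admissible measures: finite positive Borel measures supported on `G` that satisfy the weak
dynamics for all `v` of class `C¹`. (`C¹(T × Y)` consists of the restrictions of
`C¹` functions on `ℝ^{1+n}`.) -/
def measureFeasible : Set (Measure (TYW n m → ℝ)) :=
  {γ | IsFiniteMeasure γ ∧ γ P.Gᶜ = 0 ∧
    ∀ v : (TY n → ℝ) → ℝ, ContDiff ℝ 1 v →
      ∫ x, P.transport v x ∂γ = v (pointTY P.tf P.yf) - v (pointTY P.t0 P.y0)}

/-- The value `p_W^*` of the measure LP (`⊤` if there is no admissible measure). -/
def pW : EReal := ⨅ γ ∈ P.measureFeasible, ((∫ x, eval x P.lHat ∂γ : ℝ) : EReal)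

/-! ### The moment problem and its truncations -/

/-- The polynomial `∂v/∂t w₀^p + ∂v/∂y f̂` for a polynomial `v ∈ ℝ[t, y]`. -/
def polyTransport (v : MvPolynomial (TY n) ℝ) : MvPolynomial (TYW n m) ℝ :=
  rename Sum.inl (pderiv iT v) * X iW0 ^ P.p +
    ∑ i : Fin n, rename Sum.inl (pderiv (iY i) v) * P.fHat i

/-- The linear constraint on moments given by the test monomial `v_α(t, y)`. -/
def LinConstr (z : (TYW n m →₀ ℕ) → ℝ) (α : TY n →₀ ℕ) : Prop :=
  riesz z (P.polyTransport (monomial α 1)) =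
    eval (pointTY P.tf P.yf) (monomial α (1 : ℝ)) - eval (pointTY P.t0 P.y0) (monomial α (1 : ℝ))

/-- The moment sequences that are admissible for the infinite-dimensional moment problem. The
trivial constraint polynomial `g₀ = 1` is put in front of the family `g`. -/
def momentFeasible {nG : ℕ} (g : Fin nG → MvPolynomial (TYW n m) ℝ) :
    Set ((TYW n m →₀ ℕ) → ℝ) :=
  {z | (∀ α, P.LinConstr z α) ∧
    ∀ (i : Fin (nG + 1)) (d : ℕ),
      (locMatrix d ((Fin.cons 1 g : Fin (nG + 1) → MvPolynomial (TYW n m) ℝ) i) z).PosSemidef}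

/-- The value `p_∞^*` of the infinite-dimensional moment problem. -/
def pInf {nG : ℕ} (g : Fin nG → MvPolynomial (TYW n m) ℝ) : EReal :=
  ⨅ z ∈ P.momentFeasible g, ((riesz z P.lHat : ℝ) : EReal)

/-- The vectors `(z_β)`, `|β| ≤ 2d`, that are admissible for the relaxation of order `d`. The
linear constraints are those of degree at most `2d`, and the localizing matrix of `g_i` is the
largest one whose entries involve only moments of degree at most `2d`. -/
def relaxFeasible {nG : ℕ} (g : Fin nG → MvPolynomial (TYW n m) ℝ) (d : ℕ) :
    Set (MultiIdx (TYW n m) (2 * d) → ℝ) :=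
  {z | (∀ α : TY n →₀ ℕ, (P.polyTransport (monomial α 1)).totalDegree ≤ 2 * d →
      P.LinConstr (padZero z) α) ∧
    ∀ i : Fin (nG + 1),
      (locMatrix (d - halfDeg ((Fin.cons 1 g : Fin (nG + 1) → MvPolynomial (TYW n m) ℝ) i))
        ((Fin.cons 1 g : Fin (nG + 1) → MvPolynomial (TYW n m) ℝ) i) (padZero z)).PosSemidef}

/-- The value `p_d^*` of the relaxation of order `d` (used for `d ≥ d₀`). -/
def pRelax {nG : ℕ} (g : Fin nG → MvPolynomial (TYW n m) ℝ) (d : ℕ) : EReal :=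
  ⨅ z ∈ P.relaxFeasible g d, ((riesz (padZero z) P.lHat : ℝ) : EReal)

/-- The order `d₀` of the first relaxation: the smallest `d` such that all monomials of the
cost, of the dynamics (`w₀^p` and `f̂`) and of the constraints have degree at most `2d`. -/
def firstOrder {nG : ℕ} (g : Fin nG → MvPolynomial (TYW n m) ℝ) : ℕ :=
  sInf {d : ℕ | P.lHat.totalDegree ≤ 2 * d ∧ P.p ≤ 2 * d ∧
    (∀ i, (P.fHat i).totalDegree ≤ 2 * d) ∧ ∀ i, (g i).totalDegree ≤ 2 * d}

end PolyOCP

end MomentOCP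

end

/-! Equality of the moment problem and the measure LP is the dual form of Putinar's theorem together
with a density argument. The moments of an admissible measure form an admissible sequence.
Conversely, a functional that is nonnegative on the quadratic module of the `g i`, one of which is
`r - ‖x‖²`, is integration against a measure on `G` (`exists_measure_of_positivityCone`). Density of
polynomials in `C¹` on compact sets (`exists_polynomial_near_contDiff`) then extends the linear
constraints from monomials to all `C¹` test functions.

The measure is obtained as follows. For a functional `L`, the set of `p` with `L (p q²) ≥ 0` for all
`q` is closed under multiplication as soon as its elements are order bounded
(`mul_mem_positivityCone`), so it is a semiring containing `R ± X_k`. A Bernstein partition of unity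
inside this semiring shows that it contains every polynomial nonnegative on the box, up to an
arbitrarily small constant. Riesz extension and the Riesz–Markov–Kakutani theorem give a measure on
the box, and testing with squares confines it to `{g ≥ 0}`.

Truncation of sequences gives monotonicity and the bound by `pInf`. For convergence, take feasible
vectors of cost below `c` at arbitrarily high orders and pass to an ultrafilter
(`pInf_le_of_frequently`). If the masses `z_0` stay bounded, the ball constraint bounds every
moment, and the limit is admissible with cost at most `c`. If they diverge, dividing by them yields
in the limit a probability measure on `G` of nonpositive cost, and the test function `v = t` forces
`∫ w₀^p = 0`. This is impossible, since coercivity gives `l̂ ≥ δ (1 - w₀^p)` on `G`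
(`le_eval_lHat`). Coercivity enters only here, in place of an a priori bound on the mass. -/

noncomputable section

namespace MomentOCP

/-! ### Positivity cone of a functional that is nonnegative on squares -/

section PositivityCone

/-- The sequence `b, b - b², …`, which expresses `b` as a sum of squares up to a small error. -/
def squareSplit {A : Type*} [CommRing A] (b : A) : ℕ → A
  | 0 => b
  | k + 1 => squareSplit b k - squareSplit b k ^ 2

lemma squareSplit_sum {A : Type*} [CommRing A] (b : A) (k : ℕ) :
    b = ∑ i ∈ Finset.range k, squareSplit b i ^ 2 + squareSplit b k := by
  induction k with
  | zero => simp [squareSplit]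
  | succ k ih =>
    rw [Finset.sum_range_succ, squareSplit]
    nth_rewrite 1 [ih]
    ring

variable {A : Type*} [CommRing A] [Algebra ℝ A]

/-- The elements `p` such that `L` is nonnegative on `p` times every square. -/
def positivityCone (L : A →ₗ[ℝ] ℝ) : Set A := {p | ∀ q, 0 ≤ L (p * q ^ 2)}

variable {L : A →ₗ[ℝ] ℝ}

lemma add_mem_positivityCone {a b : A} (ha : a ∈ positivityCone L) (hb : b ∈ positivityCone L) :
    a + b ∈ positivityCone L := fun q => by
  rw [add_mul, map_add]; exact add_nonneg (ha q) (hb q)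

lemma smul_mem_positivityCone {a : A} {c : ℝ} (hc : 0 ≤ c) (ha : a ∈ positivityCone L) :
    c • a ∈ positivityCone L := fun q => by
  rw [smul_mul_assoc, map_smul]; exact mul_nonneg hc (ha q)

lemma sq_mul_mem_positivityCone {a : A} (b : A) (ha : a ∈ positivityCone L) :
    b ^ 2 * a ∈ positivityCone L := fun q => by
  have := ha (b * q)
  rwa [mul_pow, ← mul_assoc, mul_comm a] at this

lemma sq_mem_positivityCone (hL : (1 : A) ∈ positivityCone L) (b : A) :
    b ^ 2 ∈ positivityCone L := by
  simpa using sq_mul_mem_positivityCone b hL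

/-- The interval `[0, 1]` is preserved by `c ↦ c - c²`, with algebraic certificates `c - c² = c² (1
- c) + (1 - c)² c` and `1 - (c - c²) = (1 - c) + c²`. -/
lemma squareSplit_mem {b : A} (hb : b ∈ positivityCone L) (hb1 : 1 - b ∈ positivityCone L)
    (hL : (1 : A) ∈ positivityCone L) (k : ℕ) :
    squareSplit b k ∈ positivityCone L ∧ 1 - squareSplit b k ∈ positivityCone L := by
  induction k with
  | zero => exact ⟨hb, hb1⟩
  | succ k ih =>
    set c := squareSplit b k
    constructor
    · have := add_mem_positivityCone (sq_mul_mem_positivityCone c ih.2)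
        (sq_mul_mem_positivityCone (1 - c) ih.1)
      convert this using 1
      simp only [squareSplit]; ring
    · have := add_mem_positivityCone ih.2 (sq_mem_positivityCone hL c)
      convert this using 1
      simp only [squareSplit]; ring

/-- Replacing `b` by `∑ b_i² + b_k` turns `a b` into a sum of terms `a b_i²`, on which `L` is
nonnegative, plus the remainder `a b_k`. A weighted Cauchy–Schwarz inequality bounds the remainder
through `L (b_k² q²)`, which is small for a suitable `k`. -/
lemma mul_mem_positivityCone_of_le_one {a b : A} (hL : (1 : A) ∈ positivityCone L)
    (ha : a ∈ positivityCone L) (hb : b ∈ positivityCone L) (hb1 : 1 - b ∈ positivityCone L) :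
    a * b ∈ positivityCone L := by
  intro q
  have hmem := squareSplit_mem hb hb1 hL
  -- The partial sums of `L (b_i² q²)` are bounded by `L (b q²)`, so the terms cannot all be at
  -- least `η`.
  have hsmall : ∀ η > 0, ∃ k, L (squareSplit b k ^ 2 * q ^ 2) < η := by
    intro η hη
    by_contra! h
    have hsum : ∀ k : ℕ, (k : ℝ) * η ≤ L (b * q ^ 2) := by
      intro k
      have h1 : L (b * q ^ 2) = ∑ i ∈ Finset.range k, L (squareSplit b i ^ 2 * q ^ 2)
          + L (squareSplit b k * q ^ 2) := by
        nth_rewrite 1 [squareSplit_sum b k]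
        rw [add_mul, map_add, Finset.sum_mul, map_sum]
      have h2 := (hmem k).1 q
      have h3 : ∑ i ∈ Finset.range k, η ≤ ∑ i ∈ Finset.range k, L (squareSplit b i ^ 2 * q ^ 2) :=
        Finset.sum_le_sum fun i _ => h i
      simp at h3
      linarith
    obtain ⟨k, hk⟩ := exists_nat_gt (L (b * q ^ 2) / η)
    rw [div_lt_iff₀ hη] at hk
    linarith [hsum k]
  have hmain : ∀ k, ∀ s : ℝ, 0 < s →
      -(s * L (a ^ 2 * q ^ 2) + s⁻¹ * L (squareSplit b k ^ 2 * q ^ 2)) ≤ 2 * L (a * b * q ^ 2) := by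
    intro k s hs
    have h1 : a * b * q ^ 2 = ∑ i ∈ Finset.range k, a * (squareSplit b i * q) ^ 2
        + a * squareSplit b k * q ^ 2 := by
      nth_rewrite 1 [squareSplit_sum b k]
      rw [mul_add, add_mul, Finset.mul_sum, Finset.sum_mul]
      congr 1
      exact Finset.sum_congr rfl fun i _ => by ring
    have h2 : 0 ≤ ∑ i ∈ Finset.range k, L (a * (squareSplit b i * q) ^ 2) :=
      Finset.sum_nonneg fun i _ => ha _
    have h3 := hL ((s • a + squareSplit b k) * q)
    have h4 : (1 : A) * ((s • a + squareSplit b k) * q) ^ 2 =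
        (s ^ 2) • (a ^ 2 * q ^ 2) + (2 * s) • (a * squareSplit b k * q ^ 2)
          + squareSplit b k ^ 2 * q ^ 2 := by
      simp only [Algebra.smul_def, map_mul, map_pow, map_ofNat]
      ring
    rw [h4] at h3
    simp only [map_add, map_smul, smul_eq_mul] at h3
    rw [h1, map_add, map_sum]
    have h5 : 0 ≤ s⁻¹ * (s ^ 2 * L (a ^ 2 * q ^ 2) + 2 * s * L (a * squareSplit b k * q ^ 2) +
        L (squareSplit b k ^ 2 * q ^ 2)) := mul_nonneg (inv_pos.2 hs).le h3
    have h6 : s⁻¹ * (s ^ 2 * L (a ^ 2 * q ^ 2) + 2 * s * L (a * squareSplit b k * q ^ 2) +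
        L (squareSplit b k ^ 2 * q ^ 2)) = s * L (a ^ 2 * q ^ 2) +
          2 * L (a * squareSplit b k * q ^ 2) + s⁻¹ * L (squareSplit b k ^ 2 * q ^ 2) := by
      field_simp
    linarith
  -- If `L (a b q²) = -c < 0`, the weight `s = c / D` makes the first error term at most `c` and,
  -- for suitable `k`, the second less than `c`. The `+ 1` in `D` avoids division by zero.
  by_contra! hneg
  set c := -L (a * b * q ^ 2)
  have hc : 0 < c := by simpa [c] using hneg
  have hA : 0 ≤ L (a ^ 2 * q ^ 2) := by simpa [mul_pow] using hL (a * q)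
  set D := L (a ^ 2 * q ^ 2) + 1
  have hD : 0 < D := by positivity
  obtain ⟨k, hk⟩ := hsmall (c * (c / D)) (by positivity)
  have h := hmain k (c / D) (by positivity)
  have h1 : c / D * L (a ^ 2 * q ^ 2) ≤ c := by
    rw [div_mul_eq_mul_div, div_le_iff₀ hD]
    nlinarith
  have h2 : (c / D)⁻¹ * L (squareSplit b k ^ 2 * q ^ 2) < c := by
    rw [inv_mul_lt_iff₀ (by positivity)]
    linarith
  have h3 : L (a * b * q ^ 2) = -c := by simp [c]
  linarith

lemma mul_mem_positivityCone {a b : A} (hL : (1 : A) ∈ positivityCone L)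
    (ha : a ∈ positivityCone L) (hb : b ∈ positivityCone L) {N : ℝ} (hN : 0 < N)
    (hbN : algebraMap ℝ A N - b ∈ positivityCone L) : a * b ∈ positivityCone L := by
  have h := mul_mem_positivityCone_of_le_one hL ha
    (smul_mem_positivityCone (inv_pos.2 hN).le hb) (by
      have := smul_mem_positivityCone (inv_pos.2 hN).le hbN
      rwa [smul_sub, Algebra.smul_def _ (algebraMap ℝ A N), ← map_mul, inv_mul_cancel₀ hN.ne',
        map_one] at this)
  have h2 := smul_mem_positivityCone hN.le h
  rwa [mul_smul_comm, smul_smul, mul_inv_cancel₀ hN.ne', one_smul] at h2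

/-- An element is order bounded if `N ± b` lies in the positivity cone for some `N`. -/
def OrderBounded (L : A →ₗ[ℝ] ℝ) (b : A) : Prop :=
  ∃ N : ℝ, 0 < N ∧ algebraMap ℝ A N - b ∈ positivityCone L ∧
    algebraMap ℝ A N + b ∈ positivityCone L

lemma algebraMap_mem_positivityCone (hL : (1 : A) ∈ positivityCone L) {c : ℝ} (hc : 0 ≤ c) :
    algebraMap ℝ A c ∈ positivityCone L := by
  rw [Algebra.algebraMap_eq_smul_one]; exact smul_mem_positivityCone hc hL

lemma OrderBounded.add {a b : A} (ha : OrderBounded L a) (hb : OrderBounded L b) :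
    OrderBounded L (a + b) := by
  obtain ⟨N, hN, h1, h2⟩ := ha
  obtain ⟨M, hM, h3, h4⟩ := hb
  refine ⟨N + M, by positivity, ?_, ?_⟩
  · convert add_mem_positivityCone h1 h3 using 1
    rw [map_add]; ring
  · convert add_mem_positivityCone h2 h4 using 1
    rw [map_add]; ring

lemma OrderBounded.smul {a : A} (hL : (1 : A) ∈ positivityCone L) (ha : OrderBounded L a) (c : ℝ) :
    OrderBounded L (c • a) := by
  obtain ⟨N, hN, h1, h2⟩ := ha
  have key : ∀ c : ℝ, 0 ≤ c → OrderBounded L (c • a) := by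
    intro c hc
    refine ⟨c * N + 1, by positivity, ?_, ?_⟩
    · convert add_mem_positivityCone (smul_mem_positivityCone hc h1) hL using 1
      simp only [Algebra.smul_def, map_add, map_mul, map_one]; ring
    · convert add_mem_positivityCone (smul_mem_positivityCone hc h2) hL using 1
      simp only [Algebra.smul_def, map_add, map_mul, map_one]; ring
  rcases le_total 0 c with hc | hc
  · exact key c hc
  · obtain ⟨M, hM, h3, h4⟩ := key (-c) (by linarith)
    refine ⟨M, hM, ?_, ?_⟩
    · simpa [sub_eq_add_neg] using h4
    · simpa [sub_eq_add_neg] using h3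

/-- The upper bound comes from `2N (N² - a²) = (N - a)² (N + a) + (N + a)² (N - a)`, which needs
only multiplication by squares. -/
lemma OrderBounded.sq {a : A} (hL : (1 : A) ∈ positivityCone L) (ha : OrderBounded L a) :
    OrderBounded L (a ^ 2) := by
  obtain ⟨N, hN, h1, h2⟩ := ha
  refine ⟨N ^ 2, by positivity, ?_, ?_⟩
  · have := smul_mem_positivityCone (c := (2 * N)⁻¹) (by positivity)
      (add_mem_positivityCone (sq_mul_mem_positivityCone (algebraMap ℝ A N - a) h2)
        (sq_mul_mem_positivityCone (algebraMap ℝ A N + a) h1))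
    convert this using 1
    have : (algebraMap ℝ A N - a) ^ 2 * (algebraMap ℝ A N + a) +
        (algebraMap ℝ A N + a) ^ 2 * (algebraMap ℝ A N - a) =
        algebraMap ℝ A (2 * N) * (algebraMap ℝ A N ^ 2 - a ^ 2) := by
      rw [map_mul, map_ofNat]; ring
    rw [this, Algebra.smul_def, ← mul_assoc, ← map_mul, inv_mul_cancel₀ (by positivity), map_one,
      one_mul, map_pow]
  · exact add_mem_positivityCone (algebraMap_mem_positivityCone hL (by positivity))
      (sq_mem_positivityCone hL a)

/-- Polarization, `4ab = (a + b)² - (a - b)²`, reduces products to squares before closure of the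
cone under products is known. -/
lemma OrderBounded.mul {a b : A} (hL : (1 : A) ∈ positivityCone L) (ha : OrderBounded L a)
    (hb : OrderBounded L b) : OrderBounded L (a * b) := by
  have h := (((ha.add hb).sq hL).add (((ha.add (hb.smul hL (-1))).sq hL).smul hL (-1))).smul hL (1/4)
  convert h using 1
  have h4 : (4 : A) * algebraMap ℝ A (1/4) = 1 := by
    rw [← map_ofNat (algebraMap ℝ A), ← map_mul]; norm_num
  simp only [Algebra.smul_def, map_neg, map_one]
  linear_combination (-(a * b)) * h4

/-- The positivity cone is a semiring if every element is order bounded. -/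
def positivitySubsemiring (hL : (1 : A) ∈ positivityCone L) (hb : ∀ b : A, OrderBounded L b) :
    Subsemiring A where
  carrier := positivityCone L
  mul_mem' {a b} ha hb' := by
    obtain ⟨N, hN, h, -⟩ := hb b
    exact mul_mem_positivityCone hL ha hb' hN h
  one_mem' := hL
  add_mem' ha hb := add_mem_positivityCone ha hb
  zero_mem' := fun q => by simp

end PositivityCone

/-! ### Polynomials that are nonnegative on a box -/

section Box

variable {σ : Type*} {L : MvPolynomial σ ℝ →ₗ[ℝ] ℝ} {R : ℝ}

/-- `2R (R ± X) = (R ± X)² + (R² - X²)`. -/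
lemma C_add_X_mem (hL : 1 ∈ positivityCone L) (hR : 0 < R)
    (hX : ∀ k, C (R ^ 2) - X k ^ 2 ∈ positivityCone L) (k : σ) :
    C R + X k ∈ positivityCone L ∧ C R - X k ∈ positivityCone L := by
  have h2 : (C (2 * R)⁻¹ * C (2 * R) : MvPolynomial σ ℝ) = 1 := by
    rw [← C_mul, inv_mul_cancel₀ (by positivity), C_1]
  simp only [C_mul, map_ofNat] at h2
  constructor
  · have := smul_mem_positivityCone (c := (2 * R)⁻¹) (by positivity)
      (add_mem_positivityCone (sq_mem_positivityCone hL (C R + X k)) (hX k))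
    convert this using 1
    rw [smul_eq_C_mul, C_pow]
    linear_combination (-(C R + X k)) * h2
  · have := smul_mem_positivityCone (c := (2 * R)⁻¹) (by positivity)
      (add_mem_positivityCone (sq_mem_positivityCone hL (C R - X k)) (hX k))
    convert this using 1
    rw [smul_eq_C_mul, C_pow]
    linear_combination (-(C R - X k)) * h2

/-- Order bounded elements are closed under sums and products, so constants and coordinates suffice.
-/
lemma orderBounded_of_box (hL : 1 ∈ positivityCone L) (hR : 0 < R)
    (hX : ∀ k, C (R ^ 2) - X k ^ 2 ∈ positivityCone L) (p : MvPolynomial σ ℝ) :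
    OrderBounded L p := by
  have h1 : OrderBounded L (1 : MvPolynomial σ ℝ) :=
    ⟨1, one_pos, fun q => by simp, add_mem_positivityCone (by simpa using hL) hL⟩
  induction p using MvPolynomial.induction_on with
  | C a =>
    have := h1.smul hL a
    rwa [smul_eq_C_mul, mul_one] at this
  | add p q hp hq => exact hp.add hq
  | mul_X p k hp =>
    exact hp.mul hL ⟨R, hR, (C_add_X_mem hL hR hX k).2, (C_add_X_mem hL hR hX k).1⟩

/-- The positivity cone as a semiring, when the coordinates are bounded. -/
def boxSemiring (hL : 1 ∈ positivityCone L) (hR : 0 < R)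
    (hX : ∀ k, C (R ^ 2) - X k ^ 2 ∈ positivityCone L) : Subsemiring (MvPolynomial σ ℝ) :=
  positivitySubsemiring hL (orderBounded_of_box hL hR hX)

variable {S : Subsemiring (MvPolynomial σ ℝ)}

/-- In a semiring that contains all squares, the nonnegative constants and `R ± X_k`, the
difference `p - p(y)` is controlled by the squared distance to `y`. -/
lemma exists_sub_eval_mem [Fintype σ] (hsq : ∀ q, q ^ 2 ∈ S) (hC : ∀ c : ℝ, 0 ≤ c → C c ∈ S)
    (hR : 0 < R) (hX : ∀ k, C R + X k ∈ S ∧ C R - X k ∈ S) (p : MvPolynomial σ ℝ) :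
    ∀ ε > 0, ∃ c : ℝ, 0 ≤ c ∧ ∀ y : σ → ℝ, (∀ k, |y k| ≤ R) →
      C ε + C c * ∑ k, (X k - C (y k)) ^ 2 + (p - C (eval y p)) ∈ S ∧
      C ε + C c * ∑ k, (X k - C (y k)) ^ 2 - (p - C (eval y p)) ∈ S := by
  induction p using MvPolynomial.induction_on with
  | C a =>
    intro ε hε
    refine ⟨0, le_rfl, fun y _ => ?_⟩
    simpa using hC ε hε.le
  | add p q hp hq =>
    intro ε hε
    obtain ⟨c, hc, h⟩ := hp (ε / 2) (by positivity)
    obtain ⟨d, hd, h'⟩ := hq (ε / 2) (by positivity)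
    have he : (C ε : MvPolynomial σ ℝ) = C (ε / 2) + C (ε / 2) := by rw [← C_add, add_halves]
    refine ⟨c + d, by positivity, fun y hy => ⟨?_, ?_⟩⟩
    · convert S.add_mem (h y hy).1 (h' y hy).1 using 1
      rw [he, map_add (eval y), C_add, C_add]; ring
    · convert S.add_mem (h y hy).2 (h' y hy).2 using 1
      rw [he, map_add (eval y), C_add, C_add]; ring
  | mul_X p j hp =>
    intro ε hε
    obtain ⟨c, hc, h⟩ := hp (ε / 2 / R) (by positivity)
    obtain ⟨M, hM⟩ : ∃ M, ∀ y : σ → ℝ, (∀ k, |y k| ≤ R) → |eval y p| ≤ M := by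
      have hcpt : IsCompact (Set.univ.pi fun _ : σ => Set.Icc (-R) R) :=
        isCompact_univ_pi fun _ => isCompact_Icc
      obtain ⟨M, hM⟩ := hcpt.exists_bound_of_continuousOn
        (MvPolynomial.continuous_eval p).continuousOn
      exact ⟨M, fun y hy => hM y fun k _ => abs_le.1 (hy k)⟩
    set δ := ε / 2 with hδ
    have hδ0 : 0 < δ := by positivity
    have he : (C ε : MvPolynomial σ ℝ) = C δ + C δ := by rw [← C_add, hδ, add_halves]
    have hRδ : (C R * C (δ / R) : MvPolynomial σ ℝ) = C δ := by
      rw [← C_mul]; congr 1; field_simp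
    have hhalf : (2 * C (1/2) : MvPolynomial σ ℝ) = 1 := by
      rw [← map_ofNat (C : ℝ →+* MvPolynomial σ ℝ), ← C_mul]; norm_num
    -- Split `p X_j - p(y) y_j = X_j (p - p(y)) + p(y) (X_j - y_j)`; the two parts of the constant
    -- pay for the two summands. Since `M` bounds `|p|` on the whole box, the constant does not
    -- depend on `y`.
    refine ⟨R * c + M ^ 2 / (4 * δ), by positivity, fun y hy => ?_⟩
    obtain ⟨h1, h2⟩ := h y hy
    set E := C (δ / R) + C c * ∑ k, (X k - C (y k)) ^ 2 with hE
    set D := p - C (eval y p) with hD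
    set b := eval y p with hb
    have hM' : b ^ 2 ≤ M ^ 2 := sq_le_sq.2 ((hM y hy).trans (le_abs_self M))
    -- `2 (R E + X D) = (R + X)(E + D) + (R - X)(E - D)`, and similarly with `-D`.
    have hfst : C R * E + X j * D ∈ S ∧ C R * E - X j * D ∈ S := by
      constructor
      · convert S.mul_mem (hC (1/2) (by norm_num)) (S.add_mem (S.mul_mem (hX j).1 h1)
          (S.mul_mem (hX j).2 h2)) using 1
        linear_combination (-(C R * E + X j * D)) * hhalf
      · convert S.mul_mem (hC (1/2) (by norm_num)) (S.add_mem (S.mul_mem (hX j).1 h2)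
          (S.mul_mem (hX j).2 h1)) using 1
        linear_combination (-(C R * E - X j * D)) * hhalf
    -- Completing the square: `δ (1 + b' (X_j - y_j) / (2δ))²` contains the linear term `b' (X_j -
    -- y_j)`.
    have hdist : ∀ b' : ℝ, b' ^ 2 ≤ M ^ 2 →
        C δ + C (M ^ 2 / (4 * δ)) * ∑ k, (X k - C (y k)) ^ 2 + C b' * (X j - C (y j)) ∈ S := by
      intro b' hb'
      classical
      have hs : ∑ k, (X k - C (y k)) ^ 2 ∈ S := S.sum_mem fun k _ => hsq _
      have hs' : ∑ k ∈ Finset.univ.erase j, (X k - C (y k)) ^ 2 ∈ S :=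
        S.sum_mem fun k _ => hsq _
      have hsplit : ∑ k, (X k - C (y k)) ^ 2 = (X j - C (y j)) ^ 2 +
          ∑ k ∈ Finset.univ.erase j, (X k - C (y k)) ^ 2 :=
        (Finset.add_sum_erase _ _ (Finset.mem_univ j)).symm
      have hcoef : 0 ≤ (M ^ 2 - b' ^ 2) / (4 * δ) := div_nonneg (by linarith) (by positivity)
      convert S.add_mem (S.add_mem (S.mul_mem (hC _ hcoef) hs)
        (S.mul_mem (hC (b' ^ 2 / (4 * δ)) (by positivity)) hs'))
        (S.mul_mem (hC δ hδ0.le) (hsq (1 + C (b' / (2 * δ)) * (X j - C (y j))))) using 1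
      have e1 : (C (M ^ 2 / (4 * δ)) : MvPolynomial σ ℝ) =
          C ((M ^ 2 - b' ^ 2) / (4 * δ)) + C (b' ^ 2 / (4 * δ)) := by
        rw [← C_add]; congr 1; ring
      have e2 : (C δ * C (b' / (2 * δ)) ^ 2 : MvPolynomial σ ℝ) = C (b' ^ 2 / (4 * δ)) := by
        rw [← C_pow, ← C_mul]; congr 1; field_simp; ring
      have e3 : (2 * (C δ * C (b' / (2 * δ))) : MvPolynomial σ ℝ) = C b' := by
        rw [← map_ofNat (C : ℝ →+* MvPolynomial σ ℝ), ← C_mul, ← C_mul]; congr 1; field_simp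
      rw [e1, hsplit]
      linear_combination (-(X j - C (y j)) ^ 2) * e2 - (X j - C (y j)) * e3
    have hev : eval y (p * X j) = b * y j := by simp [hb]
    have hC1 : (C (R * c + M ^ 2 / (4 * δ)) : MvPolynomial σ ℝ)
        = C R * C c + C (M ^ 2 / (4 * δ)) := by simp
    constructor
    · convert S.add_mem hfst.1 (hdist b hM') using 1
      rw [hev, he, hC1, hE, hD, C_mul]
      linear_combination -hRδ
    · convert S.add_mem hfst.2 (hdist (-b) (by simpa using hM')) using 1
      rw [hev, he, hC1, hE, hD, C_mul, C_neg]
      linear_combination -hRδ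

lemma aeval_bernstein_mem {s : MvPolynomial σ ℝ} (hC : ∀ c : ℝ, 0 ≤ c → C c ∈ S)
    (hs : s ∈ S) (hs' : 1 - s ∈ S) (N j : ℕ) :
    Polynomial.aeval s (bernsteinPolynomial ℝ N j) ∈ S := by
  have : Polynomial.aeval s (bernsteinPolynomial ℝ N j) =
      C (N.choose j : ℝ) * s ^ j * (1 - s) ^ (N - j) := by
    simp [bernsteinPolynomial]
  rw [this]
  exact S.mul_mem (S.mul_mem (hC _ (by positivity)) (S.pow_mem hs _)) (S.pow_mem hs' _)

/-- Partition of unity in one variable with small variance. -/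
lemma exists_partition_one (hsq : ∀ q, q ^ 2 ∈ S) (hC : ∀ c : ℝ, 0 ≤ c → C c ∈ S)
    (hR : 0 < R) (hX : ∀ k, C R + X k ∈ S ∧ C R - X k ∈ S) {η : ℝ} (hη : 0 < η) :
    ∃ (N : ℕ) (y : Fin (N + 1) → ℝ) (B : σ → Fin (N + 1) → MvPolynomial σ ℝ),
      (∀ j, |y j| ≤ R) ∧ (∀ k j, B k j ∈ S) ∧ (∀ k, ∑ j, B k j = 1) ∧
      ∀ k, C η - ∑ j, B k j * (X k - C (y j)) ^ 2 ∈ S := by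
  -- After the affine change `s = (R + X) / (2R)`, the Bernstein variance `N s (1 - s)` rescales to
  -- `(4R²/N) s (1 - s)`. This is `R²/N - (R²/N) (2s - 1)²`, so `N > R²/η` is enough.
  obtain ⟨N, hN⟩ := exists_nat_gt (R ^ 2 / η)
  have hN0 : (0 : ℝ) < N := lt_of_le_of_lt (by positivity) hN
  rw [div_lt_iff₀ hη] at hN
  set s : σ → MvPolynomial σ ℝ := fun k => C (2 * R)⁻¹ * (C R + X k) with hs
  have h2 : (C (2 * R)⁻¹ * (2 * C R) : MvPolynomial σ ℝ) = 1 := by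
    rw [← map_ofNat (C : ℝ →+* MvPolynomial σ ℝ), ← C_mul, ← C_mul,
      inv_mul_cancel₀ (by positivity), C_1]
  have hs1 : ∀ k, s k ∈ S := fun k => S.mul_mem (hC _ (by positivity)) (hX k).1
  have hs2 : ∀ k, 1 - s k ∈ S := fun k => by
    convert S.mul_mem (hC (2 * R)⁻¹ (by positivity)) (hX k).2 using 1
    rw [hs]; linear_combination -h2
  have hXs : ∀ k, X k = C R * (2 * s k - 1) := fun k => by
    rw [hs]; linear_combination (-(X k : MvPolynomial σ ℝ) - C R) * h2
  refine ⟨N, fun j => R * (2 * (j / N) - 1),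
    fun k j => Polynomial.aeval (s k) (bernsteinPolynomial ℝ N j), ?_, ?_, ?_, ?_⟩
  · intro j
    have hj : (j : ℝ) / N ≤ 1 := by
      rw [div_le_one hN0]; exact_mod_cast Nat.lt_succ_iff.1 j.2
    have hj0 : 0 ≤ (j : ℝ) / N := by positivity
    rw [abs_mul, abs_of_pos hR]
    exact mul_le_of_le_one_right hR.le (abs_le.2 ⟨by linarith, by linarith⟩)
  · exact fun k j => aeval_bernstein_mem hC (hs1 k) (hs2 k) N j
  · intro k
    rw [Fin.sum_univ_eq_sum_range (fun j => Polynomial.aeval (s k) (bernsteinPolynomial ℝ N j)),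
      ← map_sum, bernsteinPolynomial.sum, map_one]
  · intro k
    have hvar := congrArg (Polynomial.aeval (s k)) (bernsteinPolynomial.variance ℝ N)
    simp only [map_sum, map_mul, map_pow, map_sub, nsmul_eq_mul, map_natCast, Polynomial.aeval_X,
      map_one] at hvar
    have hNinv : (C (N : ℝ)⁻¹ * (N : MvPolynomial σ ℝ)) = 1 := by
      rw [← map_natCast (C : ℝ →+* MvPolynomial σ ℝ), ← C_mul, inv_mul_cancel₀ hN0.ne', C_1]
    have hsum : ∑ j : Fin (N + 1), Polynomial.aeval (s k) (bernsteinPolynomial ℝ N j) *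
        (X k - C (R * (2 * (j / N) - 1))) ^ 2 = C (4 * R ^ 2 / N) * (s k * (1 - s k)) := by
      rw [Fin.sum_univ_eq_sum_range (fun j => Polynomial.aeval (s k) (bernsteinPolynomial ℝ N j) *
        (X k - C (R * (2 * (j / N) - 1))) ^ 2)]
      have : ∀ j ∈ Finset.range (N + 1),
          Polynomial.aeval (s k) (bernsteinPolynomial ℝ N j) *
            (X k - C (R * (2 * (j / N) - 1))) ^ 2 =
          4 * C R ^ 2 * C (N : ℝ)⁻¹ ^ 2 * (((N : MvPolynomial σ ℝ) * s k - (j : MvPolynomial σ ℝ)) ^ 2 *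
            Polynomial.aeval (s k) (bernsteinPolynomial ℝ N j)) := by
        intro j _
        have e : (C (R * (2 * (j / N) - 1)) : MvPolynomial σ ℝ)
            = C R * (2 * ((j : MvPolynomial σ ℝ) * C (N : ℝ)⁻¹) - 1) := by
          simp only [div_eq_mul_inv, C_mul, C_sub, C_1, map_ofNat, map_natCast]
        have e2 : X k - C R * (2 * ((j : MvPolynomial σ ℝ) * C (N : ℝ)⁻¹) - 1) =
            2 * C R * C (N : ℝ)⁻¹ * ((N : MvPolynomial σ ℝ) * s k - (j : MvPolynomial σ ℝ)) := by
          rw [hXs k]; linear_combination (-2 * C R * s k) * hNinv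
        rw [e, e2]; ring
      rw [Finset.sum_congr rfl this, ← Finset.mul_sum, hvar]
      have e3 : (C (4 * R ^ 2 / N) : MvPolynomial σ ℝ) = 4 * C R ^ 2 * C (N : ℝ)⁻¹ := by
        simp only [div_eq_mul_inv, C_mul, C_pow, map_ofNat]
      rw [e3]
      linear_combination (4 * C R ^ 2 * C (N : ℝ)⁻¹ * (s k * (1 - s k))) * hNinv
    rw [hsum]
    have hη' : 0 ≤ η - R ^ 2 / N := by
      rw [sub_nonneg, div_le_iff₀ hN0]; linarith
    convert S.add_mem (hC _ hη') (S.mul_mem (hC (R ^ 2 / N) (by positivity))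
      (hsq (2 * s k - 1))) using 1
    have e3 : (C (4 * R ^ 2 / N) : MvPolynomial σ ℝ) = 4 * C (R ^ 2 / N) := by
      rw [← map_ofNat (C : ℝ →+* MvPolynomial σ ℝ), ← C_mul]; congr 1; ring
    rw [e3, C_sub]; ring

/-- Partition of unity with small total variance. -/
lemma exists_partition [Fintype σ] (hsq : ∀ q, q ^ 2 ∈ S) (hC : ∀ c : ℝ, 0 ≤ c → C c ∈ S)
    (hR : 0 < R) (hX : ∀ k, C R + X k ∈ S ∧ C R - X k ∈ S) {η : ℝ} (hη : 0 < η) :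
    ∃ (N : ℕ) (y : (σ → Fin (N + 1)) → σ → ℝ) (B : (σ → Fin (N + 1)) → MvPolynomial σ ℝ),
      (∀ i k, |y i k| ≤ R) ∧ (∀ i, B i ∈ S) ∧
      (∃ T : Finset (σ → Fin (N + 1)), ∑ i ∈ T, B i = 1 ∧
        C η - ∑ i ∈ T, B i * ∑ k, (X k - C (y i k)) ^ 2 ∈ S) := by
  classical
  obtain ⟨N, y, B, hy, hB, hB1, hBv⟩ := exists_partition_one hsq hC hR hX
    (η := η / (Fintype.card σ + 1)) (by positivity)
  -- Take products of the one-variable partitions. In each coordinate variance the other factors sum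
  -- to `1`, so the variances add up; the `+ 1` in the choice of `η` covers an empty `σ`.
  refine ⟨N, fun φ k => y (φ k), fun φ => ∏ k, B k (φ k), fun φ k => hy _,
    fun φ => S.prod_mem fun k _ => hB _ _, Fintype.piFinset fun _ => Finset.univ, ?_, ?_⟩
  · rw [← Finset.prod_univ_sum]
    exact Finset.prod_eq_one fun k _ => hB1 k
  · have hl : ∀ l, ∑ φ ∈ Fintype.piFinset fun _ : σ => (Finset.univ : Finset (Fin (N + 1))),
        (∏ k, B k (φ k)) * (X l - C (y (φ l))) ^ 2 = ∑ j, B l j * (X l - C (y j)) ^ 2 := by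
      intro l
      have h1 : ∀ φ : σ → Fin (N + 1), (∏ k, B k (φ k)) * (X l - C (y (φ l))) ^ 2 =
          ∏ k, (B k (φ k) * if k = l then (X k - C (y (φ k))) ^ 2 else 1) := by
        intro φ
        rw [Finset.prod_mul_distrib, Finset.prod_ite_eq' Finset.univ l]
        simp
      simp_rw [h1]
      rw [← Finset.prod_univ_sum (fun _ : σ => (Finset.univ : Finset (Fin (N + 1))))
        (fun k j => B k j * if k = l then (X k - C (y j)) ^ 2 else 1)]
      rw [Finset.prod_eq_single l]
      · simp
      · intro k _ hk
        simp [hk, hB1]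
      · simp
    have hsum : ∑ φ ∈ Fintype.piFinset fun _ : σ => (Finset.univ : Finset (Fin (N + 1))),
        (∏ k, B k (φ k)) * ∑ k, (X k - C (y (φ k))) ^ 2 =
        ∑ l, ∑ j, B l j * (X l - C (y j)) ^ 2 := by
      simp_rw [Finset.mul_sum]
      rw [Finset.sum_comm]
      exact Finset.sum_congr rfl fun l _ => hl l
    rw [hsum]
    convert S.add_mem (hC (η / (Fintype.card σ + 1)) (by positivity))
      (S.sum_mem (t := Finset.univ) fun l _ => hBv l) using 1
    rw [Finset.sum_sub_distrib, Finset.sum_const, Finset.card_univ, nsmul_eq_mul,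
      ← map_natCast (C : ℝ →+* MvPolynomial σ ℝ), ← C_mul, ← add_sub_assoc, ← C_add]
    congr 2
    field_simp
    ring

/-- A polynomial that is nonnegative on the box is, up to a small constant, in every semiring
that contains all squares, the nonnegative constants and `R ± X_k`. -/
lemma add_C_mem_of_nonneg_on_box [Fintype σ] (hsq : ∀ q, q ^ 2 ∈ S)
    (hC : ∀ c : ℝ, 0 ≤ c → C c ∈ S) (hR : 0 < R) (hX : ∀ k, C R + X k ∈ S ∧ C R - X k ∈ S)
    {p : MvPolynomial σ ℝ} (hp : ∀ x : σ → ℝ, (∀ k, |x k| ≤ R) → 0 ≤ eval x p) {ε : ℝ}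
    (hε : 0 < ε) : p + C (ε + ε) ∈ S := by
  obtain ⟨c, hc, hcl⟩ := exists_sub_eval_mem hsq hC hR hX p ε hε
  obtain ⟨N, y, B, hy, hB, T, hB1, hBv⟩ := exists_partition hsq hC hR hX
    (η := ε / (c + 1)) (by positivity)
  have hcoef : 0 ≤ ε - c * (ε / (c + 1)) := by
    rw [sub_nonneg, ← mul_div_assoc, div_le_iff₀ (by positivity)]; nlinarith
  -- `p + 2ε` is the sum of `m1`, `m2`, `c` times the variance bound, and the constant `ε - c η`:
  -- locally `p` is replaced by its nonnegative values `p(y_i)`.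
  have m1 : ∑ i ∈ T, B i * (C ε + C c * ∑ k, (X k - C (y i k)) ^ 2 + (p - C (eval (y i) p))) ∈ S :=
    S.sum_mem fun i _ => S.mul_mem (hB i) (hcl (y i) (hy i)).1
  have m2 : ∑ i ∈ T, B i * C (eval (y i) p) ∈ S :=
    S.sum_mem fun i _ => S.mul_mem (hB i) (hC _ (hp (y i) (hy i)))
  have e : ∑ i ∈ T, B i * (C ε + C c * ∑ k, (X k - C (y i k)) ^ 2 + (p - C (eval (y i) p))) =
      (∑ i ∈ T, B i) * (C ε + p) + C c * ∑ i ∈ T, B i * ∑ k, (X k - C (y i k)) ^ 2 -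
        ∑ i ∈ T, B i * C (eval (y i) p) := by
    rw [Finset.sum_mul, Finset.mul_sum, ← Finset.sum_add_distrib, ← Finset.sum_sub_distrib]
    exact Finset.sum_congr rfl fun i _ => by ring
  have m3 := S.mul_mem (hC c hc) hBv
  have m4 := hC _ hcoef
  rw [e, hB1] at m1
  rw [C_sub, C_mul] at m4
  convert S.add_mem (S.add_mem (S.add_mem m1 m2) m3) m4 using 1
  rw [C_add]
  ring

end Box

/-- A functional that is nonnegative on squares and on the products of squares with `R² - X_k²`
is nonnegative on the polynomials that are nonnegative on the box of radius `R`. -/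
theorem nonneg_of_nonneg_on_box {σ : Type*} [Fintype σ] {L : MvPolynomial σ ℝ →ₗ[ℝ] ℝ} {R : ℝ}
    (hL : 1 ∈ positivityCone L) (hR : 0 < R)
    (hX : ∀ k, C (R ^ 2) - X k ^ 2 ∈ positivityCone L) {p : MvPolynomial σ ℝ}
    (hp : ∀ x : σ → ℝ, (∀ k, |x k| ≤ R) → 0 ≤ eval x p) : 0 ≤ L p := by
  set S := boxSemiring hL hR hX
  have hsq : ∀ q, q ^ 2 ∈ S := fun q => sq_mem_positivityCone hL q
  have hC : ∀ c : ℝ, 0 ≤ c → C c ∈ S := fun c hc => algebraMap_mem_positivityCone hL hc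
  have hX' : ∀ k, C R + X k ∈ S ∧ C R - X k ∈ S := fun k => C_add_X_mem hL hR hX k
  have hpos : ∀ q ∈ S, 0 ≤ L q := fun q hq => by simpa using (show q ∈ positivityCone L from hq) 1
  have h1 : 0 ≤ L 1 := hpos 1 S.one_mem
  have key : ∀ ε > 0, 0 ≤ L p + 2 * ε * L 1 := by
    intro ε hε
    have hmem : p + C (2 * ε) ∈ S := by
      rw [two_mul]; exact add_C_mem_of_nonneg_on_box hsq hC hR hX' hp hε
    have := hpos _ hmem
    rwa [map_add, ← mul_one (C (2 * ε)), ← smul_eq_C_mul, map_smul, smul_eq_mul] at this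
  by_contra! hneg
  have := key (-L p / (4 * (L 1 + 1))) (div_pos (by linarith) (by positivity))
  have h2 : 2 * (-L p / (4 * (L 1 + 1))) * L 1 ≤ -L p / 2 := by
    have : 2 * (-L p / (4 * (L 1 + 1))) * L 1 = (-L p / 2) * (L 1 / (L 1 + 1)) := by
      field_simp; ring
    rw [this]
    exact mul_le_of_le_one_right (by linarith) ((div_le_one (by positivity)).2 (by linarith))
  linarith

/-! ### Representing measures -/

/-- Polynomial functions as an algebra homomorphism into the continuous functions. -/
def polyToContinuousMap (σ : Type*) : MvPolynomial σ ℝ →ₐ[ℝ] C(σ → ℝ, ℝ) :=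
  aeval fun k => ⟨fun x => x k, continuous_apply k⟩

lemma polyToContinuousMap_apply {σ : Type*} (p : MvPolynomial σ ℝ) (x : σ → ℝ) :
    polyToContinuousMap σ p x = eval x p := by
  induction p using MvPolynomial.induction_on with
  | C a => simp [polyToContinuousMap]
  | add p q hp hq => simp [hp, hq]
  | mul_X p k hp => simp [hp]; simp [polyToContinuousMap]

/-- The Weierstrass approximation theorem on compact subsets of `ℝ^σ`. -/
lemma exists_polynomial_near {σ : Type*} {K : Set (σ → ℝ)} (hK : IsCompact K) {f : (σ → ℝ) → ℝ}
    (hf : Continuous f) {ε : ℝ} (hε : 0 < ε) :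
    ∃ p : MvPolynomial σ ℝ, ∀ x ∈ K, |eval x p - f x| < ε := by
  have hsep : (polyToContinuousMap σ).range.SeparatesPoints := by
    intro x y hxy
    obtain ⟨k, hk⟩ := Function.ne_iff.1 hxy
    refine ⟨_, ⟨polyToContinuousMap σ (X k), ⟨X k, rfl⟩, rfl⟩, ?_⟩
    simpa [polyToContinuousMap_apply] using hk
  obtain ⟨_, ⟨p, rfl⟩, hp⟩ :=
    ContinuousMap.exists_mem_subalgebra_near_continuous_of_isCompact_of_separatesPoints hsep
      ⟨f, hf⟩ hK hε
  refine ⟨p, fun x hx => ?_⟩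
  have := hp x hx
  erw [polyToContinuousMap_apply] at this
  exact this

/-- Haviland's theorem on a compact set: `L` depends only on restrictions to `K`, extends to a
positive functional on `C(K)`, and is represented there by a measure, which is pushed forward to the
ambient space. -/
lemma exists_measure_of_nonneg_on_compact {σ : Type*} [Fintype σ] {K : Set (σ → ℝ)}
    (hK : IsCompact K) {L : MvPolynomial σ ℝ →ₗ[ℝ] ℝ}
    (hL : ∀ p, (∀ x ∈ K, 0 ≤ eval x p) → 0 ≤ L p) :
    ∃ μ : Measure (σ → ℝ), IsFiniteMeasure μ ∧ μ Kᶜ = 0 ∧ ∀ p, L p = ∫ x, eval x p ∂μ := by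
  have : CompactSpace K := isCompact_iff_compactSpace.1 hK
  set E : MvPolynomial σ ℝ →ₗ[ℝ] C(K, ℝ) :=
    (ContinuousMap.compRightAlgHom ℝ ℝ
      (⟨Subtype.val, continuous_subtype_val⟩ : C(K, σ → ℝ))).toLinearMap ∘ₗ
      (polyToContinuousMap σ).toLinearMap with hE
  have hEa : ∀ p (x : K), E p x = eval x.1 p := fun p x => polyToContinuousMap_apply p x.1
  -- A polynomial vanishing on `K` is nonnegative there, and so is its negative.
  have hker : LinearMap.ker E ≤ LinearMap.ker L := by
    intro p hp
    have h0 : ∀ x ∈ K, eval x p = 0 := fun x hx => by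
      rw [← hEa p ⟨x, hx⟩, LinearMap.mem_ker.1 hp]; rfl
    have h1 := hL p fun x hx => (h0 x hx).ge
    have h2 := hL (-p) fun x hx => by rw [map_neg, h0 x hx, neg_zero]
    rw [map_neg] at h2
    exact LinearMap.mem_ker.2 (by linarith)
  set F : C(K, ℝ) →ₗ.[ℝ] ℝ :=
    ⟨LinearMap.range E, (LinearMap.ker E).liftQ L hker ∘ₗ E.quotKerEquivRange.symm.toLinearMap⟩
    with hF
  have hFE : ∀ p, F ⟨E p, p, rfl⟩ = L p := by
    intro p
    have : E.quotKerEquivRange.symm ⟨E p, p, rfl⟩ = (LinearMap.ker E).mkQ p := by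
      rw [LinearEquiv.symm_apply_eq]; rfl
    change (LinearMap.ker E).liftQ L hker (E.quotKerEquivRange.symm ⟨E p, p, rfl⟩) = L p
    rw [this]; rfl
  obtain ⟨Λ, hΛ, hΛ0⟩ := riesz_extension (PointedCone.positive ℝ C(K, ℝ)) F
    (by
      rintro ⟨_, p, rfl⟩ hp
      rw [hFE p]
      exact hL p fun x hx => by
        rw [← hEa p ⟨x, hx⟩]; exact hp ⟨x, hx⟩)
    -- Riesz extension needs every function to be dominated from the subspace; the constant `‖y‖`
    -- does it.
    (by
      intro y
      refine ⟨⟨E (C ‖y‖), _, rfl⟩, ?_⟩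
      intro x
      have h1 := neg_le_of_abs_le (y.norm_coe_le_norm x)
      have h2 : E (C ‖y‖) x = ‖y‖ := by rw [hEa]; simp
      change 0 ≤ E (C ‖y‖) x + y x
      rw [h2]; linarith)
  set Λc : CompactlySupportedContinuousMap K ℝ →ₚ[ℝ] ℝ := PositiveLinearMap.mk₀
    { toFun := fun f => Λ f.toContinuousMap
      map_add' := fun f g => by rw [← map_add]; rfl
      map_smul' := fun c f => by rw [RingHom.id_apply, ← map_smul]; rfl }
    (fun f hf => hΛ0 _ fun x => hf x) with hΛc
  refine ⟨(RealRMK.rieszMeasure Λc).map Subtype.val, inferInstance, ?_, fun p => ?_⟩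
  · rw [Measure.map_apply (by fun_prop) hK.measurableSet.compl]
    simp
  · rw [integral_map (by fun_prop) (MvPolynomial.continuous_eval p).aestronglyMeasurable]
    have h := RealRMK.integral_rieszMeasure Λc (CompactlySupportedContinuousMap.continuousMapEquiv (E p))
    have h2 : Λc (CompactlySupportedContinuousMap.continuousMapEquiv (E p)) = L p := by
      rw [← hFE p, ← hΛ]; rfl
    rw [← h2, ← h]
    exact integral_congr_ae (.of_forall fun x => hEa p x)

lemma integrable_of_compact {X : Type*} [TopologicalSpace X] [MeasurableSpace X] [T2Space X]
    [BorelSpace X]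
    {μ : Measure X} [IsFiniteMeasure μ] {K : Set X} (hK : IsCompact K) (hμ : μ Kᶜ = 0) {f : X → ℝ}
    (hf : Continuous f) : Integrable f μ := by
  rw [← Measure.restrict_eq_self_of_ae_mem (measure_eq_zero_iff_ae_notMem.1 hμ |>.mono fun x hx => not_not.1 hx)]
  exact hf.continuousOn.integrableOn_compact hK

/-- If `∫ q² h ≥ 0` for all polynomials `q`, a compactly supported measure lives on `{h ≥ 0}`. -/
lemma ae_nonneg_of_integral_sq_mul_nonneg {σ : Type*} [Fintype σ] {K : Set (σ → ℝ)}
    (hK : IsCompact K) {μ : Measure (σ → ℝ)} [IsFiniteMeasure μ] (hμ : μ Kᶜ = 0)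
    {h : (σ → ℝ) → ℝ} (hh : Continuous h)
    (hpos : ∀ q : MvPolynomial σ ℝ, 0 ≤ ∫ x, h x * eval x q ^ 2 ∂μ) : ∀ᵐ x ∂μ, 0 ≤ h x := by
  have hKae : ∀ᵐ x ∂μ, x ∈ K := (measure_eq_zero_iff_ae_notMem.1 hμ).mono fun x hx => not_not.1 hx
  -- With `φ² = h⁻`, the negative part of `h`, one has `h φ² = -(h⁻)²`. Approximating `φ` by
  -- polynomials yields `∫ (h⁻)² ≤ 0`.
  set φ : (σ → ℝ) → ℝ := fun x => Real.sqrt (max (-h x) 0) with hφ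
  have hφc : Continuous φ := by fun_prop
  have hφ2 : ∀ x, h x * φ x ^ 2 = -(max (-h x) 0) ^ 2 := by
    intro x
    rw [hφ]
    simp only
    rw [Real.sq_sqrt (le_max_right _ _)]
    rcases le_total 0 (h x) with h0 | h0
    · rw [max_eq_right (by linarith)]; ring
    · rw [max_eq_left (by linarith)]; ring
  have hnn : 0 ≤ ∫ x, h x * φ x ^ 2 ∂μ := by
    choose q hq using fun k : ℕ => exists_polynomial_near hK hφc (ε := 1 / ((k : ℝ) + 1))
      (by positivity)
    obtain ⟨M, hM⟩ := hK.exists_bound_of_continuousOn hh.continuousOn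
    obtain ⟨M', hM'⟩ := hK.exists_bound_of_continuousOn hφc.continuousOn
    refine ge_of_tendsto' (f := fun k => ∫ x, h x * eval x (q k) ^ 2 ∂μ) (x := atTop) ?_
      fun k => hpos (q k)
    refine tendsto_integral_of_dominated_convergence (fun _ => M * (M' + 1) ^ 2) ?_
      (integrable_const _) ?_ ?_
    · exact fun k => (hh.mul ((MvPolynomial.continuous_eval (q k)).pow 2)).aestronglyMeasurable
    · intro k
      filter_upwards [hKae] with x hx
      rw [norm_mul, norm_pow]
      have h1 : ‖eval x (q k)‖ ≤ M' + 1 := by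
        have h3 := hq k x hx
        have h4 := hM' x hx
        have h5 : 1 / ((k : ℝ) + 1) ≤ 1 := by
          rw [div_le_one (by positivity)]; linarith [(Nat.cast_nonneg k : (0 : ℝ) ≤ k)]
        rw [Real.norm_eq_abs] at h4 ⊢
        calc |eval x (q k)| = |(eval x (q k) - φ x) + φ x| := by ring_nf
          _ ≤ |eval x (q k) - φ x| + |φ x| := abs_add_le _ _
          _ ≤ M' + 1 := by linarith
      have := hM x hx
      gcongr
      exact (norm_nonneg _).trans this
    · filter_upwards [hKae] with x hx
      refine Tendsto.mul tendsto_const_nhds (Tendsto.pow ?_ 2)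
      rw [tendsto_iff_norm_sub_tendsto_zero]
      exact squeeze_zero (fun _ => norm_nonneg _) (fun k => (hq k x hx).le)
        tendsto_one_div_add_atTop_nhds_zero_nat
  simp_rw [hφ2] at hnn
  rw [integral_neg] at hnn
  have h0 : ∫ x, (max (-h x) 0) ^ 2 ∂μ = 0 :=
    le_antisymm (by linarith) (integral_nonneg fun x => sq_nonneg _)
  rw [integral_eq_zero_iff_of_nonneg (fun x => sq_nonneg _)
    (integrable_of_compact hK hμ (f := fun x => max (-h x) 0 ^ 2)
      ((hh.neg.max continuous_const).pow 2))] at h0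
  filter_upwards [h0] with x hx
  have : max (-h x) 0 = 0 := by simpa using hx
  linarith [le_max_left (-h x) 0]

/-- Putinar's theorem on moments: a functional that is nonnegative on the quadratic module
generated by `g`, one of whose members is `r - ‖x‖²`, is integration against a measure on
`{g ≥ 0}`. -/
theorem exists_measure_of_positivityCone {σ ι : Type*} [Fintype σ] [Countable ι]
    {L : MvPolynomial σ ℝ →ₗ[ℝ] ℝ} {g : ι → MvPolynomial σ ℝ} (hL : 1 ∈ positivityCone L)
    (hg : ∀ i, g i ∈ positivityCone L) (hball : ∃ i r, g i = C r - ∑ k, X k ^ 2) :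
    ∃ μ : Measure (σ → ℝ), IsFiniteMeasure μ ∧ μ {x | ∀ i, 0 ≤ eval x (g i)}ᶜ = 0 ∧
      ∀ p, L p = ∫ x, eval x p ∂μ := by
  classical
  obtain ⟨i, r, hi⟩ := hball
  set R := |r| + 1 with hR
  have hR0 : 0 < R := by positivity
  have hRr : 0 ≤ R ^ 2 - r := by nlinarith [abs_nonneg r, le_abs_self r]
  -- `R² - X_k² = (R² - r) + (r - ∑ X_j²) + ∑_{j ≠ k} X_j²`.
  have hX : ∀ k, C (R ^ 2) - X k ^ 2 ∈ positivityCone L := by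
    intro k
    have hs : ∑ j ∈ Finset.univ.erase k, (X j : MvPolynomial σ ℝ) ^ 2 ∈ positivityCone L := by
      refine Finset.sum_induction _ (· ∈ positivityCone L)
        (fun _ _ => add_mem_positivityCone) (fun q => by simp) fun j _ => ?_
      exact sq_mem_positivityCone hL _
    have h1 := add_mem_positivityCone (add_mem_positivityCone
      (algebraMap_mem_positivityCone hL hRr) (hg i)) hs
    convert h1 using 1
    rw [hi, ← Finset.add_sum_erase _ _ (Finset.mem_univ k), algebraMap_eq, C_sub]
    ring
  have hK : IsCompact (Set.univ.pi fun _ : σ => Set.Icc (-R) R) :=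
    isCompact_univ_pi fun _ => isCompact_Icc
  obtain ⟨μ, hfin, hμ, hint⟩ := exists_measure_of_nonneg_on_compact hK (L := L) fun p hp =>
    nonneg_of_nonneg_on_box hL hR0 hX fun x hx => hp x fun k _ => abs_le.1 (hx k)
  refine ⟨μ, hfin, ?_, hint⟩
  rw [← mem_ae_iff]
  change ∀ᵐ x ∂μ, ∀ i, 0 ≤ eval x (g i)
  rw [ae_all_iff]
  intro j
  refine ae_nonneg_of_integral_sq_mul_nonneg hK hμ (MvPolynomial.continuous_eval (g j)) fun q => ?_
  have := hg j q
  rw [hint] at this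
  simpa using this

/-! ### Polynomials are dense in `C¹` -/

section COne

variable {σ : Type*} [Fintype σ]

lemma hasFDerivAt_eval (p : MvPolynomial σ ℝ) (x : σ → ℝ) :
    HasFDerivAt (fun x => eval x p)
      (∑ k, eval x (pderiv k p) • ContinuousLinearMap.proj (R := ℝ) (φ := fun _ : σ => ℝ) k) x := by
  classical
  induction p using MvPolynomial.induction_on with
  | C a => simpa using hasFDerivAt_const a x
  | add p q hp hq =>
    simp only [map_add, add_smul, Finset.sum_add_distrib]
    exact hp.add hq
  | mul_X p j hp =>
    have h := hp.mul (hasFDerivAt_apply (𝕜 := ℝ) j x)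
    simp only [map_mul, eval_X]
    refine h.congr_fderiv ?_
    ext y
    simp [Derivation.leibniz, pderiv_X, Pi.single_apply, Finset.mul_sum, add_mul,
      Finset.sum_add_distrib, apply_ite]
    refine Finset.sum_congr rfl fun k _ => by ring

lemma fderiv_eval_single [DecidableEq σ] (p : MvPolynomial σ ℝ) (x : σ → ℝ) (k : σ) :
    fderiv ℝ (fun x => eval x p) x (Pi.single k 1) = eval x (pderiv k p) := by
  rw [(hasFDerivAt_eval p x).fderiv]
  simp [Pi.single_apply]

lemma contDiff_eval (p : MvPolynomial σ ℝ) : ContDiff ℝ 1 (fun x => eval x p) := by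
  induction p using MvPolynomial.induction_on with
  | C a => simpa using contDiff_const
  | add p q hp hq => simpa using hp.add hq
  | mul_X p j hp => simpa using hp.mul (contDiff_apply ℝ ℝ j)

/-- The convolution of a polynomial with a compactly supported function is a polynomial. -/
lemma exists_polynomial_eq_integral (q : MvPolynomial σ ℝ) {h : (σ → ℝ) → ℝ} (hh : Continuous h)
    (hc : HasCompactSupport h) :
    ∃ P : MvPolynomial σ ℝ, ∀ x, ∫ t, eval (x - t) q * h t = eval x P := by
  induction q using MvPolynomial.induction_on generalizing h with
  | C a => exact ⟨C (a * ∫ t, h t), fun x => by simp [integral_const_mul]⟩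
  | add p q hp hq =>
    obtain ⟨P, hP⟩ := hp hh hc
    obtain ⟨Q, hQ⟩ := hq hh hc
    refine ⟨P + Q, fun x => ?_⟩
    rw [map_add, ← hP, ← hQ, ← integral_add]
    · simp [add_mul]
    · exact (((MvPolynomial.continuous_eval p).comp (by fun_prop)).mul
        hh).integrable_of_hasCompactSupport hc.mul_left
    · exact (((MvPolynomial.continuous_eval q).comp (by fun_prop)).mul
        hh).integrable_of_hasCompactSupport hc.mul_left
  | mul_X p j hp =>
    obtain ⟨P, hP⟩ := hp hh hc
    -- In `(x_j - t_j) h(t)` the factor `t_j` is absorbed into the kernel, so the induction must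
    -- range over all `h`.
    have hh' : Continuous fun t : σ → ℝ => t j * h t := (continuous_apply j).mul hh
    have hc' : HasCompactSupport fun t : σ → ℝ => t j * h t := hc.mul_left
    obtain ⟨Q, hQ⟩ := hp hh' hc'
    refine ⟨P * X j - Q, fun x => ?_⟩
    rw [map_sub, map_mul, eval_X, ← hP, ← hQ, ← integral_mul_const, ← integral_sub]
    · refine integral_congr_ae (.of_forall fun t => ?_)
      simp; ring
    · exact ((((MvPolynomial.continuous_eval p).comp (by fun_prop)).mul
        hh).integrable_of_hasCompactSupport hc.mul_left).mul_const _
    · exact (((MvPolynomial.continuous_eval p).comp (by fun_prop)).mul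
        hh').integrable_of_hasCompactSupport hc'.mul_left

open ContinuousLinearMap in
open scoped Convolution in
-- At `x` the convolution sees `a` and `b` only on `x - tsupport h`, so a polynomial `a` may be
-- compared with a bump `b` although it is close to `b` only on a compact set.
lemma abs_convolution_sub_le {a b h : (σ → ℝ) → ℝ} (ha : Continuous a) (hb : Continuous b)
    (hh : Continuous h) (hc : HasCompactSupport h) {η : ℝ} {x : σ → ℝ}
    (hη : ∀ t, x - t ∈ tsupport h → |a t - b t| ≤ η) :
    |(a ⋆[lsmul ℝ ℝ, volume] h) x - (b ⋆[lsmul ℝ ℝ, volume] h) x| ≤ η * ∫ t, |h t| := by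
  have hint : ∀ c : (σ → ℝ) → ℝ, Continuous c → Integrable fun t => c t • h (x - t) := by
    intro c hcc
    exact hc.convolutionExists_right (L := lsmul ℝ ℝ) hcc.locallyIntegrable hh x
  simp only [convolution_def, lsmul_apply]
  rw [← integral_sub (hint a ha) (hint b hb)]
  calc |∫ t, (a t • h (x - t) - b t • h (x - t))| ≤ ∫ t, |a t • h (x - t) - b t • h (x - t)| :=
        abs_integral_le_integral_abs
    _ ≤ ∫ t, η * |h (x - t)| := by
        refine integral_mono ((hint a ha).sub (hint b hb)).abs ?_ fun t => ?_
        · have h1 : Integrable h := hh.integrable_of_hasCompactSupport hc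
          exact ((h1.comp_sub_left x).abs).const_mul η
        · simp only [smul_eq_mul]
          rw [← sub_mul, abs_mul]
          by_cases ht : x - t ∈ tsupport h
          · exact mul_le_mul_of_nonneg_right (hη t ht) (abs_nonneg _)
          · simp [image_eq_zero_of_notMem_tsupport ht]
    _ = η * ∫ t, |h t| := by
        rw [integral_const_mul, integral_sub_left_eq_self (fun t => |h t|)]

open ContinuousLinearMap in
open scoped Convolution in
/-- Polynomials approximate a compactly supported `C¹` function and its derivative. -/
lemma exists_polynomial_near_of_hasCompactSupport [DecidableEq σ] {K : Set (σ → ℝ)}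
    (hK : IsCompact K)
    {v : (σ → ℝ) → ℝ} (hv : ContDiff ℝ 1 v) (hc : HasCompactSupport v) {ε : ℝ} (hε : 0 < ε) :
    ∃ p : MvPolynomial σ ℝ, ∀ x ∈ K, |eval x p - v x| ≤ ε ∧
      ∀ k, |eval x (pderiv k p) - fderiv ℝ v x (Pi.single k 1)| ≤ ε := by
  set D : σ → (σ → ℝ) → ℝ := fun k x => fderiv ℝ v x (Pi.single k 1) with hD
  have hDc : ∀ k, Continuous (D k) := fun k =>
    (hv.continuous_fderiv one_ne_zero).clm_apply continuous_const
  have hDs : ∀ k, tsupport (D k) ⊆ tsupport v := fun k => tsupport_fderiv_apply_subset ℝ _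
  have hDcs : ∀ k, HasCompactSupport (D k) := fun k => hc.fderiv_apply ℝ _
  have hunif : ∀ h : (σ → ℝ) → ℝ, Continuous h → HasCompactSupport h → ∃ δ > 0, ∀ φ :
      ContDiffBump (0 : σ → ℝ), φ.rOut ≤ δ → ∀ x,
        |(φ.normed volume ⋆[lsmul ℝ ℝ, volume] h) x - h x| ≤ ε / 2 := by
    intro h hh hhc
    obtain ⟨δ, hδ, hu⟩ := Metric.uniformContinuous_iff.1
      (hhc.uniformContinuous_of_continuous hh) (ε / 2) (by positivity)
    refine ⟨δ, hδ, fun φ hφ x => ?_⟩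
    rw [← Real.dist_eq]
    exact φ.dist_normed_convolution_le hh.aestronglyMeasurable fun y hy =>
      (hu ((Metric.mem_ball.1 hy).trans_le hφ)).le
  obtain ⟨δ₀, hδ₀, h₀⟩ := hunif v hv.continuous hc
  choose δ₁ hδ₁ h₁ using fun k => hunif (D k) (hDc k) (hDcs k)
  obtain ⟨δ, hδ, hδ0, hδ1⟩ : ∃ δ > 0, δ ≤ δ₀ ∧ ∀ k, δ ≤ δ₁ k := by
    obtain ⟨d, hd, hd'⟩ : ∃ d > 0, ∀ k, d ≤ δ₁ k := by
      rcases isEmpty_or_nonempty σ with he | hne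
      · exact ⟨1, one_pos, fun k => he.elim k⟩
      · obtain ⟨k, hk⟩ := Finite.exists_min δ₁
        exact ⟨δ₁ k, hδ₁ k, hk⟩
    exact ⟨min δ₀ d, lt_min hδ₀ hd, min_le_left _ _, fun k => (min_le_right _ _).trans (hd' k)⟩
  set φ : ContDiffBump (0 : σ → ℝ) := ⟨δ / 2, δ, by positivity, by linarith⟩ with hφ
  set b := φ.normed volume with hb
  have hbc : Continuous b := φ.continuous_normed
  -- On `K - tsupport v` a polynomial `q` replaces the mollifier; `q ⋆ v` is then itself a
  -- polynomial.
  have hK' : IsCompact ((fun z : (σ → ℝ) × (σ → ℝ) => z.1 - z.2) '' (K ×ˢ tsupport v)) :=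
    (hK.prod hc.isCompact).image (by fun_prop)
  set I := (∫ t, |v t|) + ∑ k, ∫ t, |D k t| with hI
  have hn : ∀ h : (σ → ℝ) → ℝ, 0 ≤ ∫ t, |h t| := fun h => integral_nonneg fun _ => abs_nonneg _
  have hns : 0 ≤ ∑ k, ∫ t, |D k t| := Finset.sum_nonneg fun k _ => hn (D k)
  have hI0 : 0 ≤ I := add_nonneg (hn v) hns
  have hIv : ∫ t, |v t| ≤ I := le_add_of_nonneg_right hns
  have hID : ∀ k, ∫ t, |D k t| ≤ I := fun k =>
    (Finset.single_le_sum (f := fun k => ∫ t, |D k t|) (fun k _ => hn (D k))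
      (Finset.mem_univ k)).trans (le_add_of_nonneg_left (hn v))
  set η := ε / 2 / (I + 1) with hη
  have hη0 : 0 < η := by positivity
  have hηI : η * I ≤ ε / 2 := by
    rw [hη, div_mul_eq_mul_div, div_le_iff₀ (by positivity)]
    nlinarith
  obtain ⟨q, hq⟩ := exists_polynomial_near hK' hbc hη0
  set a : (σ → ℝ) → ℝ := fun x => eval x q with ha
  have hac : Continuous a := MvPolynomial.continuous_eval q
  have hab : ∀ x ∈ K, ∀ t, x - t ∈ tsupport v → |a t - b t| ≤ η := fun x hx t ht =>
    (hq t ⟨(x, x - t), ⟨hx, ht⟩, by simp⟩).le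
  have key : ∀ h : (σ → ℝ) → ℝ, Continuous h → HasCompactSupport h → tsupport h ⊆ tsupport v →
      ∫ t, |h t| ≤ I → (∀ x, |(b ⋆[lsmul ℝ ℝ, volume] h) x - h x| ≤ ε / 2) → ∀ x ∈ K,
      |(a ⋆[lsmul ℝ ℝ, volume] h) x - h x| ≤ ε := by
    intro h hh hhc hsub hhI hbh x hx
    have h1 := abs_convolution_sub_le hac hbc hh hhc (fun t ht => hab x hx t (hsub ht))
    have h2 := mul_le_mul_of_nonneg_left hhI hη0.le
    have h3 := abs_sub_le ((a ⋆[lsmul ℝ ℝ, volume] h) x) ((b ⋆[lsmul ℝ ℝ, volume] h) x) (h x)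
    linarith [hbh x]
  obtain ⟨p, hp⟩ := exists_polynomial_eq_integral q hv.continuous hc
  have hpa : (fun x => eval x p) = (a ⋆[lsmul ℝ ℝ, volume] v) := by
    funext x
    rw [← hp x, convolution_eq_swap]
    simp [ha]
  refine ⟨p, fun x hx => ⟨?_, fun k => ?_⟩⟩
  · have := key v hv.continuous hc subset_rfl hIv (h₀ φ hδ0) x hx
    rwa [← hpa] at this
  -- The derivative falls on `v`, so the estimate for `v` applies verbatim to each `∂_k v`.
  · have h1 := (hc.hasFDerivAt_convolution_right (lsmul ℝ ℝ) (hac.locallyIntegrable (μ := volume))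
      hv x).fderiv
    rw [← fderiv_eval_single, hpa, h1, convolution_precompR_apply _ hac.locallyIntegrable
      (hc.fderiv ℝ) (hv.continuous_fderiv one_ne_zero)]
    exact key (D k) (hDc k) (hDcs k) (hDs k) (hID k) (h₁ k φ (hδ1 k)) x hx

/-- Polynomials approximate a `C¹` function and its derivative uniformly on compact sets. -/
theorem exists_polynomial_near_contDiff [DecidableEq σ] {K : Set (σ → ℝ)} (hK : IsCompact K)
    {v : (σ → ℝ) → ℝ} (hv : ContDiff ℝ 1 v) {ε : ℝ} (hε : 0 < ε) :
    ∃ p : MvPolynomial σ ℝ, ∀ x ∈ K, |eval x p - v x| ≤ ε ∧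
      ∀ k, |eval x (pderiv k p) - fderiv ℝ v x (Pi.single k 1)| ≤ ε := by
  obtain ⟨ρ, hρ0, hρ⟩ := hK.isBounded.subset_ball_lt 0 0
  set χ : ContDiffBump (0 : σ → ℝ) := ⟨ρ, ρ + 1, hρ0, by linarith⟩ with hχ
  obtain ⟨p, hp⟩ := exists_polynomial_near_of_hasCompactSupport hK (v := fun x => χ x * v x)
    (χ.contDiff.mul hv) χ.hasCompactSupport.mul_right hε
  refine ⟨p, fun x hx => ?_⟩
  have heq : (fun x => χ x * v x) =ᶠ[𝓝 x] v := by
    filter_upwards [Metric.isOpen_ball.mem_nhds (hρ hx)] with y hy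
    rw [χ.one_of_mem_closedBall (Metric.ball_subset_closedBall hy), one_mul]
  have h := hp x hx
  rw [heq.fderiv_eq] at h
  rwa [show χ x * v x = v x from heq.self_of_nhds] at h

end COne

/-! ### The Riesz functional and localizing matrices -/

section Riesz

variable {σ : Type*}

lemma riesz_eq_sum_of_subset (z : (σ →₀ ℕ) → ℝ) (q : MvPolynomial σ ℝ) {s : Finset (σ →₀ ℕ)}
    (hs : q.support ⊆ s) : riesz z q = ∑ α ∈ s, q.coeff α * z α :=
  Finset.sum_subset hs fun α _ hα => by rw [notMem_support_iff.1 hα, zero_mul]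

/-- The functional `riesz z` as a linear map. -/
def rieszLin (z : (σ →₀ ℕ) → ℝ) : MvPolynomial σ ℝ →ₗ[ℝ] ℝ where
  toFun := riesz z
  map_add' p q := by
    classical
    rw [riesz_eq_sum_of_subset z (p + q) support_add,
      riesz_eq_sum_of_subset z p Finset.subset_union_left,
      riesz_eq_sum_of_subset z q Finset.subset_union_right, ← Finset.sum_add_distrib]
    exact Finset.sum_congr rfl fun α _ => by rw [coeff_add, add_mul]
  map_smul' c q := by
    rw [riesz_eq_sum_of_subset z (c • q) (support_smul (a := c)), riesz, RingHom.id_apply,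
      smul_eq_mul, Finset.mul_sum]
    exact Finset.sum_congr rfl fun α _ => by rw [coeff_smul, smul_eq_mul, mul_assoc]

@[simp] lemma rieszLin_apply (z : (σ →₀ ℕ) → ℝ) (q : MvPolynomial σ ℝ) :
    rieszLin z q = riesz z q := rfl

lemma riesz_monomial (z : (σ →₀ ℕ) → ℝ) (α : σ →₀ ℕ) (c : ℝ) :
    riesz z (monomial α c) = c * z α := by
  classical
  rw [riesz_eq_sum_of_subset z _ support_monomial_subset]
  simp

lemma riesz_of_linearMap (L : MvPolynomial σ ℝ →ₗ[ℝ] ℝ) (q : MvPolynomial σ ℝ) :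
    riesz (fun α => L (monomial α 1)) q = L q := by
  nth_rewrite 2 [q.as_sum]
  rw [map_sum, riesz]
  refine Finset.sum_congr rfl fun α _ => ?_
  rw [← smul_eq_mul, ← map_smul, smul_monomial, smul_eq_mul, mul_one]

lemma riesz_congr {z z' : (σ →₀ ℕ) → ℝ} {q : MvPolynomial σ ℝ} {k : ℕ} (hq : q.totalDegree ≤ k)
    (h : ∀ α : σ →₀ ℕ, α.degree ≤ k → z α = z' α) : riesz z q = riesz z' q :=
  Finset.sum_congr rfl fun α hα => by rw [h α ((le_totalDegree hα).trans hq)]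

lemma padZero_of_le {k : ℕ} (s : (σ →₀ ℕ) → ℝ) {α : σ →₀ ℕ} (h : α.degree ≤ k) :
    padZero (fun β : MultiIdx σ k => s β.1) α = s α := by
  simp [padZero, h]

lemma riesz_padZero {k : ℕ} (s : (σ →₀ ℕ) → ℝ) {q : MvPolynomial σ ℝ} (hq : q.totalDegree ≤ k) :
    riesz (padZero fun β : MultiIdx σ k => s β.1) q = riesz s q :=
  riesz_congr hq fun _ h => padZero_of_le s h

lemma totalDegree_linearCombination_le {d : ℕ} (x : MultiIdx σ d →₀ ℝ) :
    (Finsupp.linearCombination ℝ (fun α : MultiIdx σ d => monomial (R := ℝ) α.1 1) x).totalDegree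
      ≤ d := by
  rw [Finsupp.linearCombination_apply]
  refine totalDegree_finsetSum_le fun α _ => (totalDegree_smul_le _ _).trans ?_
  exact (totalDegree_monomial_le _ _).trans α.2

lemma exists_linearCombination_eq {d : ℕ} {q : MvPolynomial σ ℝ} (hq : q.totalDegree ≤ d) :
    ∃ x : MultiIdx σ d →₀ ℝ,
      Finsupp.linearCombination ℝ (fun α : MultiIdx σ d => monomial (R := ℝ) α.1 1) x = q := by
  refine ⟨∑ α ∈ q.support.attach,
    Finsupp.single ⟨α.1, (le_totalDegree α.2).trans hq⟩ (q.coeff α.1), ?_⟩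
  rw [map_sum]
  simp only [Finsupp.linearCombination_single, smul_monomial, smul_eq_mul, mul_one]
  rw [Finset.sum_attach q.support fun α => monomial α (q.coeff α)]
  exact q.as_sum.symm

lemma locMatrix_form {d : ℕ} (g : MvPolynomial σ ℝ) (z : (σ →₀ ℕ) → ℝ) (x : MultiIdx σ d →₀ ℝ) :
    (x.sum fun i xi => x.sum fun j xj => star xi * locMatrix d g z i j * xj) =
      riesz z (g * (Finsupp.linearCombination ℝ
        (fun α : MultiIdx σ d => monomial (R := ℝ) α.1 1) x) ^ 2) := by
  rw [← rieszLin_apply, Finsupp.linearCombination_apply, Finsupp.sum, Finsupp.sum, sq,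
    Finset.sum_mul_sum, Finset.mul_sum, map_sum]
  refine Finset.sum_congr rfl fun i _ => ?_
  rw [Finset.mul_sum, map_sum, Finsupp.sum]
  refine Finset.sum_congr rfl fun j _ => ?_
  rw [smul_mul_smul_comm, monomial_mul, mul_smul_comm, map_smul, rieszLin_apply, locMatrix]
  simp
  ring

/-- The localizing matrix is positive semidefinite if and only if the functional is nonnegative
on the multiples of `g` by squares. -/
lemma locMatrix_posSemidef_iff {d : ℕ} {g : MvPolynomial σ ℝ} {z : (σ →₀ ℕ) → ℝ} :
    (locMatrix d g z).PosSemidef ↔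
      ∀ q : MvPolynomial σ ℝ, q.totalDegree ≤ d → 0 ≤ riesz z (g * q ^ 2) := by
  constructor
  · intro h q hq
    obtain ⟨x, rfl⟩ := exists_linearCombination_eq hq
    rw [← locMatrix_form]
    exact h.2 x
  · intro h
    refine ⟨?_, fun x => ?_⟩
    · ext α β
      simp [locMatrix, add_comm]
    · rw [locMatrix_form]
      exact h _ (totalDegree_linearCombination_le x)

lemma forall_locMatrix_posSemidef_iff {g : MvPolynomial σ ℝ} {z : (σ →₀ ℕ) → ℝ} :
    (∀ d, (locMatrix d g z).PosSemidef) ↔ g ∈ positivityCone (rieszLin z) :=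
  ⟨fun h q => locMatrix_posSemidef_iff.1 (h q.totalDegree) q le_rfl,
    fun h _ => locMatrix_posSemidef_iff.2 fun q _ => h q⟩

/-- The bound on `deg g` gives `halfDeg g ≤ d`, so the natural subtraction does not truncate. -/
lemma totalDegree_mul_sq_le {g q : MvPolynomial σ ℝ} {d : ℕ} (hg : g.totalDegree ≤ 2 * d)
    (hq : q.totalDegree ≤ d - halfDeg g) : (g * q ^ 2).totalDegree ≤ 2 * d := by
  have h1 := totalDegree_mul g (q ^ 2)
  have h2 := totalDegree_pow q 2
  unfold halfDeg at hq
  omega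

end Riesz

/-! ### Coercivity of the homogenized cost -/

section Homogenize

variable {n m : ℕ}

lemma eval_homogenize {p : ℕ} {q : MvPolynomial (TYU n m) ℝ} (hq : CtrlDegreeLE p q)
    {x : TYW n m → ℝ} (hx : x iW0 ≠ 0) :
    eval x (homogenize p q) = x iW0 ^ p *
      eval (pointTYU (x (Sum.inl iT)) (fun i => x (Sum.inl (iY i)))
        (fun j => x (iW j) / x iW0)) q := by
  rw [eval_eq' _ q, homogenize, map_sum, Finset.mul_sum]
  refine Finset.sum_congr rfl fun α hα => ?_
  have hp : x iW0 ^ p = x iW0 ^ (p - ∑ j : Fin m, α (Sum.inr j)) *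
      ∏ j : Fin m, x iW0 ^ α (Sum.inr j) := by
    rw [Finset.prod_pow_eq_pow_sum, ← pow_add, Nat.sub_add_cancel (hq α hα)]
  have hprod : ∏ j : Fin m, x iW0 ^ α (Sum.inr j) *
      (x (iW j) / x iW0) ^ α (Sum.inr j) = ∏ j : Fin m, x (iW j) ^ α (Sum.inr j) :=
    Finset.prod_congr rfl fun j _ => by rw [← mul_pow, mul_div_cancel₀ _ hx]
  simp only [map_mul, map_prod, map_pow, eval_C, eval_X, Fintype.prod_sum_type, pointTYU, pointTY,
    Sum.elim_inl, Sum.elim_inr]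
  rw [hp, ← hprod, Finset.prod_mul_distrib]
  ring

/-- For `w₀ = s > 0`, homogeneity gives `l̂ = s^p l(t, y, w/s) ≥ δ ∑ w_j^p`, a bound independent of
`s`. Letting `s` vary freely with `w` fixed, continuity reaches `w₀ = 0`. -/
lemma le_eval_lHat {P : PolyOCP n m} (hp : Even P.p) (hl : CtrlDegreeLE P.p P.l)
    {δ : ℝ}
    (hcoercive : ∀ t ∈ Set.Icc P.t0 P.tf, ∀ y ∈ P.Y, ∀ u : Fin m → ℝ,
      δ * ∑ j : Fin m, |u j| ^ P.p ≤ eval (pointTYU t y u) P.l)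
    {x : TYW n m → ℝ} (hx : x ∈ P.G) : δ * (1 - x iW0 ^ P.p) ≤ eval x P.lHat := by
  classical
  obtain ⟨ht, hy, hw0, -, hw⟩ := hx
  have hw1 : 1 - x iW0 ^ P.p = ∑ j : Fin m, x (iW j) ^ P.p := by
    have : x iW0 ^ P.p = 1 - ∑ j : Fin m, x (iW j) ^ P.p := hw
    linarith
  rw [hw1]
  have hclosed : IsClosed {s : ℝ | δ * ∑ j : Fin m, x (iW j) ^ P.p ≤
      eval (Function.update x iW0 s) P.lHat} :=
    isClosed_le continuous_const
      ((MvPolynomial.continuous_eval _).comp (continuous_const.update _ continuous_id))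
  have hsub : Set.Ioi (0 : ℝ) ⊆ {s : ℝ | δ * ∑ j : Fin m, x (iW j) ^ P.p ≤
      eval (Function.update x iW0 s) P.lHat} := by
    intro s hs
    have hs0 : (0 : ℝ) < s := hs
    have h1 := hcoercive _ ht _ hy fun j => x (iW j) / s
    have h2 := eval_homogenize hl (x := Function.update x iW0 s) (by simpa using hs0.ne')
    simp only [Function.update_self] at h2
    have h3 : ∀ k : TYW n m, k ≠ iW0 → Function.update x iW0 s k = x k := fun k hk =>
      Function.update_of_ne hk _ _
    simp only [h3 (Sum.inl iT) (by simp), h3 (Sum.inl (iY _)) (by simp), h3 (iW _) (by simp)] at h2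
    change _ ≤ eval _ (homogenize P.p P.l)
    rw [h2]
    refine le_trans (le_of_eq ?_) (mul_le_mul_of_nonneg_left h1 (pow_nonneg hs0.le P.p))
    rw [mul_left_comm, Finset.mul_sum _ _ (s ^ P.p)]
    congr 1
    refine Finset.sum_congr rfl fun j _ => ?_
    rw [hp.pow_abs, ← mul_pow, mul_div_cancel₀ _ hs0.ne']
  have h := (closure_minimal hsub hclosed) (by
    rw [closure_Ioi]; exact hw0.1 : x iW0 ∈ closure (Set.Ioi (0 : ℝ)))
  simpa using h

end Homogenize

/-! ### Limits of truncated moment sequences -/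

section Limit

variable {σ : Type*}

lemma riesz_smul (c : ℝ) (z : (σ →₀ ℕ) → ℝ) (q : MvPolynomial σ ℝ) :
    riesz (fun α => c * z α) q = c * riesz z q := by
  rw [riesz, riesz, Finset.mul_sum]
  exact Finset.sum_congr rfl fun α _ => by ring

lemma tendsto_riesz {ι : Type*} {l : Filter ι} {s : ι → (σ →₀ ℕ) → ℝ} {z : (σ →₀ ℕ) → ℝ}
    (h : ∀ α, Tendsto (fun d => s d α) l (𝓝 (z α))) (q : MvPolynomial σ ℝ) :
    Tendsto (fun d => riesz (s d) q) l (𝓝 (riesz z q)) :=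
  tendsto_finsetSum _ fun α _ => (h α).const_mul _

lemma riesz_sq_monomial (s : (σ →₀ ℕ) → ℝ) (α : σ →₀ ℕ) :
    riesz s (monomial α 1 ^ 2) = s (2 • α) := by
  rw [monomial_pow, one_pow, riesz_monomial, one_mul]

/-- Bounds on the even moments of a truncated sequence with a ball constraint. -/
lemma even_moment_le [Fintype σ] {s : (σ →₀ ℕ) → ℝ} {r : ℝ} {k : ℕ}
    (hsq : ∀ q : MvPolynomial σ ℝ, q.totalDegree ≤ k → 0 ≤ riesz s (q ^ 2))
    (hball : ∀ q : MvPolynomial σ ℝ, q.totalDegree ≤ k - 1 →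
      0 ≤ riesz s ((C r - ∑ k, X k ^ 2) * q ^ 2)) (N : ℕ) :
    ∀ α : σ →₀ ℕ, α.degree = N → N ≤ k → s (2 • α) ≤ |r| ^ N * s 0 := by
  have hnn : ∀ α : σ →₀ ℕ, α.degree ≤ k → 0 ≤ s (2 • α) := fun α hα => by
    rw [← riesz_sq_monomial s]
    exact hsq _ ((totalDegree_monomial_le _ _).trans hα)
  induction N with
  | zero =>
    intro α hα _
    rw [(Finsupp.degree_eq_zero_iff α).1 hα]
    simp
  | succ N ih =>
    intro α hα hk
    -- Write `α = e_j + β` and test the ball constraint with `x^β`: the moments at `2(e_k + β)` are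
    -- nonnegative and sum to at most `r s(2β)`.
    obtain ⟨j, hj⟩ : ∃ j, α j ≠ 0 := by
      by_contra! h
      have : α = 0 := Finsupp.ext h
      simp [this] at hα
    have hle : Finsupp.single j 1 ≤ α := by
      rw [Finsupp.single_le_iff]; omega
    obtain ⟨β, rfl⟩ := exists_add_of_le hle
    have hβ : β.degree = N := by
      rw [map_add, Finsupp.degree_single] at hα; omega
    have h1 := hball (monomial β 1) ((totalDegree_monomial_le _ _).trans (by
      change β.degree ≤ k - 1; omega))
    have h2 : riesz s ((C r - ∑ k, X k ^ 2) * monomial β 1 ^ 2) =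
        r * s (2 • β) - ∑ k, s (2 • (Finsupp.single k 1 + β)) := by
      rw [sub_mul, Finset.sum_mul, ← rieszLin_apply, map_sub, map_sum, ← smul_eq_C_mul, map_smul]
      simp only [rieszLin_apply, riesz_sq_monomial, smul_eq_mul]
      congr 1
      refine Finset.sum_congr rfl fun k _ => ?_
      rw [← riesz_sq_monomial s, ← mul_pow]
      congr 2
      rw [X, monomial_mul, one_mul]
    have h3 : s (2 • (Finsupp.single j 1 + β)) ≤ ∑ k, s (2 • (Finsupp.single k 1 + β)) :=
      Finset.single_le_sum (f := fun k => s (2 • (Finsupp.single k 1 + β))) (fun k _ => hnn _ (by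
        rw [map_add, Finsupp.degree_single]; omega)) (Finset.mem_univ j)
    have h4 : r * s (2 • β) ≤ |r| * s (2 • β) :=
      mul_le_mul_of_nonneg_right (le_abs_self r) (hnn β (by omega))
    have h5 := mul_le_mul_of_nonneg_left (ih β hβ (by omega)) (abs_nonneg r)
    rw [pow_succ, mul_right_comm, mul_comm _ |r|]
    linarith

/-- `(1 ± x^α)²` has nonnegative integral, so `2 |s_α| ≤ s_0 + s_{2α}`. -/
lemma abs_moment_le [Fintype σ] {s : (σ →₀ ℕ) → ℝ} {r : ℝ} {k : ℕ}
    (hsq : ∀ q : MvPolynomial σ ℝ, q.totalDegree ≤ k → 0 ≤ riesz s (q ^ 2))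
    (hball : ∀ q : MvPolynomial σ ℝ, q.totalDegree ≤ k - 1 →
      0 ≤ riesz s ((C r - ∑ k, X k ^ 2) * q ^ 2)) {α : σ →₀ ℕ} (hα : α.degree ≤ k) :
    |s α| ≤ (1 + |r| ^ α.degree) * s 0 := by
  have h1 := even_moment_le hsq hball _ α rfl hα
  have hexp : ∀ c : ℝ, riesz s ((1 + c • monomial α 1) ^ 2) =
      s 0 + 2 * c * s α + c ^ 2 * s (2 • α) := by
    intro c
    have : (1 + c • monomial α 1 : MvPolynomial σ ℝ) ^ 2 =
        monomial 0 1 + (2 * c) • monomial α 1 + (c ^ 2) • (monomial α 1) ^ 2 := by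
      simp only [smul_eq_C_mul, C_mul, C_pow, map_ofNat, monomial_zero', C_1]; ring
    rw [this, ← rieszLin_apply, map_add, map_add, map_smul, map_smul, rieszLin_apply,
      rieszLin_apply, rieszLin_apply, riesz_sq_monomial, riesz_monomial, riesz_monomial]
    simp
  have hdeg : ∀ c : ℝ, (1 + c • monomial α 1 : MvPolynomial σ ℝ).totalDegree ≤ k := fun c =>
    (totalDegree_add _ _).trans (max_le (by simp)
      ((totalDegree_smul_le _ _).trans ((totalDegree_monomial_le _ _).trans hα)))
  have h2 := hsq _ (hdeg 1)
  have h3 := hsq _ (hdeg (-1))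
  rw [hexp] at h2 h3
  have h0 : 0 ≤ s 0 := by
    have := hsq (monomial 0 1) ((totalDegree_monomial_le _ _).trans (by simp))
    rw [riesz_sq_monomial] at this
    simpa using this
  have h4 : 0 ≤ |r| ^ α.degree * s 0 := mul_nonneg (by positivity) h0
  rw [abs_le]
  constructor <;> linarith

/-- Truncated moment sequences of increasing order and bounded mass have a limit along every
ultrafilter, and the limit satisfies all positivity constraints. -/
theorem exists_moment_limit [Fintype σ] {ι : Type*} {g : ι → MvPolynomial σ ℝ}
    (hone : ∃ i, g i = 1) (hball : ∃ i r, g i = C r - ∑ k, X k ^ 2)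
    {s : ℕ → (σ →₀ ℕ) → ℝ} {U : Ultrafilter ℕ} (hU : (U : Filter ℕ) ≤ atTop)
    (hs : ∀ᶠ d in (U : Filter ℕ), ∀ i (q : MvPolynomial σ ℝ), q.totalDegree ≤ d - halfDeg (g i) →
      0 ≤ riesz (s d) (g i * q ^ 2)) {M : ℝ} (hM : ∀ᶠ d in (U : Filter ℕ), s d 0 ≤ M) :
    ∃ z : (σ →₀ ℕ) → ℝ, (∀ α, Tendsto (fun d => s d α) U (𝓝 (z α))) ∧
      ∀ i, g i ∈ positivityCone (rieszLin z) := by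
  obtain ⟨i₁, hi₁⟩ := hone
  obtain ⟨i₂, r, hi₂⟩ := hball
  have hge : ∀ k : ℕ, ∀ᶠ d in (U : Filter ℕ), k ≤ d := fun k => hU (eventually_ge_atTop k)
  -- So the ball constraint of order `d` may be tested with all `q` of degree at most `d - 1`.
  have hhalf : halfDeg (g i₂) ≤ 1 := by
    have : (g i₂).totalDegree ≤ 2 := by
      rw [hi₂]
      refine (totalDegree_sub _ _).trans (max_le (by simp) (totalDegree_finsetSum_le fun k _ => ?_))
      exact (totalDegree_pow _ _).trans (by simp)
    unfold halfDeg
    omega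
  have hlim : ∀ α, ∃ a, Tendsto (fun d => s d α) U (𝓝 a) := by
    intro α
    have hmem : Set.Icc (-((1 + |r| ^ α.degree) * M)) ((1 + |r| ^ α.degree) * M) ∈
        U.map fun d => s d α := by
      rw [Ultrafilter.mem_map]
      filter_upwards [hs, hM, hge α.degree] with d h1 h2 h3
      refine abs_le.1 ((abs_moment_le (k := d) (fun q hq => ?_) (fun q hq => ?_) h3).trans
        (mul_le_mul_of_nonneg_left h2 (by positivity)))
      · have := h1 i₁ q (by rw [hi₁]; simpa [halfDeg] using hq)
        rwa [hi₁, one_mul] at this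
      · have := h1 i₂ q (by omega)
        rwa [hi₂] at this
    obtain ⟨a, -, ha⟩ := isCompact_Icc.ultrafilter_le_nhds _ (le_principal_iff.2 hmem)
    exact ⟨a, ha⟩
  choose z hz using hlim
  refine ⟨z, hz, fun i q => ?_⟩
  refine ge_of_tendsto (tendsto_riesz hz (g i * q ^ 2)) ?_
  filter_upwards [hs, hge (q.totalDegree + halfDeg (g i))] with d h1 h2
  exact h1 i q (by omega)

end Limit

namespace PolyOCP

variable {n m : ℕ} {P : PolyOCP n m}

/-! ### The transport operator -/

lemma eval_polyTransport (v : MvPolynomial (TY n) ℝ) (x : TYW n m → ℝ) :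
    eval x (P.polyTransport v) = P.transport (fun y => eval y v) x := by
  simp only [polyTransport, transport, fderiv_eval_single, map_add, map_mul, map_sum, map_pow,
    eval_X, eval_rename]
  rfl

lemma polyTransport_add (v w : MvPolynomial (TY n) ℝ) :
    P.polyTransport (v + w) = P.polyTransport v + P.polyTransport w := by
  simp only [polyTransport, map_add, add_mul, Finset.sum_add_distrib]
  ring

lemma polyTransport_smul (c : ℝ) (v : MvPolynomial (TY n) ℝ) :
    P.polyTransport (c • v) = c • P.polyTransport v := by
  simp only [polyTransport, smul_eq_C_mul, pderiv_C_mul, map_mul, rename_C, mul_add, mul_assoc,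
    Finset.mul_sum]

/-- The test function `v = t` fixes `∫ w₀^p` at `t_f - t₀`, whatever the mass. -/
lemma polyTransport_time :
    P.polyTransport (monomial (Finsupp.single iT 1) 1) = X iW0 ^ P.p := by
  have h : (monomial (Finsupp.single iT 1) 1 : MvPolynomial (TY n) ℝ) = X iT := rfl
  simp [polyTransport, h, pderiv_X]

lemma continuous_transport {v : (TY n → ℝ) → ℝ} (hv : ContDiff ℝ 1 v) :
    Continuous (P.transport v) := by
  have h : ∀ e : TY n → ℝ, Continuous fun x : TYW n m → ℝ => fderiv ℝ v (fun s => x (Sum.inl s)) e :=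
    fun e => ((hv.continuous_fderiv one_ne_zero).comp (by fun_prop)).clm_apply continuous_const
  exact ((h _).mul ((continuous_apply _).pow _)).add
    (continuous_finsetSum _ fun i _ => (h _).mul (MvPolynomial.continuous_eval _))

/-- The linear constraints on the moments of a measure on a compact set imply the weak dynamics
for all `C¹` test functions. -/
lemma integral_transport_of_linConstr {K : Set (TYW n m → ℝ)} (hK : IsCompact K)
    {γ : Measure (TYW n m → ℝ)} [IsFiniteMeasure γ] (hγ : γ Kᶜ = 0) {z : (TYW n m →₀ ℕ) → ℝ}
    (hz : ∀ q, riesz z q = ∫ x, eval x q ∂γ) (hlin : ∀ α, P.LinConstr z α)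
    {v : (TY n → ℝ) → ℝ} (hv : ContDiff ℝ 1 v) :
    ∫ x, P.transport v x ∂γ = v (pointTY P.tf P.yf) - v (pointTY P.t0 P.y0) := by
  have hpoly : ∀ w : MvPolynomial (TY n) ℝ, ∫ x, P.transport (fun y => eval y w) x ∂γ =
      eval (pointTY P.tf P.yf) w - eval (pointTY P.t0 P.y0) w := by
    intro w
    simp_rw [← eval_polyTransport]
    rw [← hz]
    induction w using MvPolynomial.induction_on' with
    | monomial α a =>
      have h : (monomial α a : MvPolynomial (TY n) ℝ) = a • monomial α 1 := by
        rw [smul_monomial, smul_eq_mul, mul_one]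
      rw [h, polyTransport_smul, ← rieszLin_apply, map_smul, rieszLin_apply,
        show riesz z (P.polyTransport (monomial α 1)) = _ from hlin α, smul_eval, smul_eval,
        smul_eq_mul, mul_sub]
    | add p q hp hq =>
      rw [polyTransport_add, ← rieszLin_apply, map_add, rieszLin_apply, rieszLin_apply, hp, hq,
        map_add, map_add]
      ring
  set H : (TYW n m → ℝ) → ℝ := fun x => |x iW0 ^ P.p| + ∑ i, |eval x (P.fHat i)| with hH
  have hHc : Continuous H := by
    refine Continuous.add (by fun_prop) (continuous_finsetSum _ fun i _ => ?_)
    exact (MvPolynomial.continuous_eval _).abs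
  have hKae : ∀ᵐ x ∂γ, x ∈ K := (measure_eq_zero_iff_ae_notMem.1 hγ).mono fun x hx => not_not.1 hx
  -- The endpoints are adjoined because the right-hand side is evaluated there; they account for the
  -- `2` in `hest`.
  set K' : Set (TY n → ℝ) := (fun x : TYW n m → ℝ => fun s => x (Sum.inl s)) '' K ∪
    {pointTY P.tf P.yf, pointTY P.t0 P.y0} with hK'
  have hK'c : IsCompact K' := (hK.image (by fun_prop)).union (Set.toFinite _).isCompact
  set Δ := v (pointTY P.tf P.yf) - v (pointTY P.t0 P.y0) with hΔ
  have hest : ∀ ε > 0, |∫ x, P.transport v x ∂γ - Δ| ≤ ε * (∫ x, H x ∂γ + 2) := by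
    intro ε hε
    obtain ⟨w, hw⟩ := exists_polynomial_near_contDiff hK'c hv hε
    have h1 : |∫ x, P.transport v x ∂γ - ∫ x, P.transport (fun y => eval y w) x ∂γ| ≤
        ε * ∫ x, H x ∂γ := by
      have i1 := integrable_of_compact hK hγ (P.continuous_transport hv)
      have i2 := integrable_of_compact hK hγ (P.continuous_transport (contDiff_eval w))
      have i3 := integrable_of_compact hK hγ hHc
      rw [← integral_sub i1 i2, ← integral_const_mul]
      refine abs_integral_le_integral_abs.trans
        (integral_mono_ae (i1.sub i2).abs (i3.const_mul ε) ?_)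
      filter_upwards [hKae] with x hx
      have hwx := (hw _ (Or.inl ⟨x, hx, rfl⟩)).2
      have e : P.transport v x - P.transport (fun y => eval y w) x =
          (fderiv ℝ v (fun s => x (Sum.inl s)) (Pi.single iT 1) -
            eval (fun s => x (Sum.inl s)) (pderiv iT w)) * x iW0 ^ P.p +
          ∑ i, (fderiv ℝ v (fun s => x (Sum.inl s)) (Pi.single (iY i) 1) -
            eval (fun s => x (Sum.inl s)) (pderiv (iY i) w)) * eval x (P.fHat i) := by
        simp only [transport, fderiv_eval_single, sub_mul, Finset.sum_sub_distrib]
        ring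
      rw [e, hH]
      simp only
      rw [mul_add, Finset.mul_sum]
      refine (abs_add_le _ _).trans (add_le_add ?_
        ((Finset.abs_sum_le_sum_abs _ _).trans (Finset.sum_le_sum fun i _ => ?_)))
      · rw [abs_mul, abs_sub_comm]
        exact mul_le_mul_of_nonneg_right (hwx _) (abs_nonneg _)
      · rw [abs_mul, abs_sub_comm]
        exact mul_le_mul_of_nonneg_right (hwx _) (abs_nonneg _)
    have h2 := (hw _ (Or.inr (Or.inl rfl) : pointTY P.tf P.yf ∈ K')).1
    have h3 := (hw _ (Or.inr (Or.inr rfl) : pointTY P.t0 P.y0 ∈ K')).1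
    rw [hpoly w] at h1
    rw [abs_le] at *
    constructor <;> linarith [h1.1, h1.2, h2.1, h2.2, h3.1, h3.2]
  have hnn : 0 ≤ ∫ x, H x ∂γ := integral_nonneg fun x => by
    simp only [hH]; positivity
  have h0 : |∫ x, P.transport v x ∂γ - Δ| ≤ 0 := by
    refine le_of_forall_pos_le_add fun ε hε => ?_
    have := hest (ε / (∫ x, H x ∂γ + 2)) (by positivity)
    rwa [div_mul_cancel₀ _ (by positivity), ← zero_add ε] at this
  exact sub_eq_zero.1 (abs_eq_zero.1 (le_antisymm h0 (abs_nonneg _)))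

end PolyOCP

/-! ### Comparison of the three values and convergence of the relaxations -/

namespace PolyOCP

variable {n m : ℕ} {P : PolyOCP n m} {nG : ℕ} {g : Fin nG → MvPolynomial (TYW n m) ℝ}

lemma firstOrder_spec (P : PolyOCP n m) (g : Fin nG → MvPolynomial (TYW n m) ℝ) {d : ℕ}
    (hd : P.firstOrder g ≤ d) :
    P.lHat.totalDegree ≤ 2 * d ∧ P.p ≤ 2 * d ∧ ∀ i, (g i).totalDegree ≤ 2 * d := by
  have h := Nat.sInf_mem (s := {d : ℕ | P.lHat.totalDegree ≤ 2 * d ∧ P.p ≤ 2 * d ∧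
    (∀ i, (P.fHat i).totalDegree ≤ 2 * d) ∧ ∀ i, (g i).totalDegree ≤ 2 * d}) (by
    -- Any common upper bound shows that the set is nonempty, so its `sInf` belongs to it rather
    -- than being the default `0`.
    refine ⟨P.lHat.totalDegree + P.p + ∑ i, (P.fHat i).totalDegree + ∑ i, (g i).totalDegree,
      by omega, by omega, fun i => ?_, fun i => ?_⟩
    · have := Finset.single_le_sum (f := fun i => (P.fHat i).totalDegree)
        (fun _ _ => Nat.zero_le _) (Finset.mem_univ i)
      omega
    · have := Finset.single_le_sum (f := fun i => (g i).totalDegree)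
        (fun _ _ => Nat.zero_le _) (Finset.mem_univ i)
      omega)
  change P.lHat.totalDegree ≤ 2 * P.firstOrder g ∧ P.p ≤ 2 * P.firstOrder g ∧
    (∀ i, (P.fHat i).totalDegree ≤ 2 * P.firstOrder g) ∧
    ∀ i, (g i).totalDegree ≤ 2 * P.firstOrder g at h
  exact ⟨by omega, by omega, fun i => (h.2.2.2 i).trans (by omega)⟩

lemma totalDegree_cons_le {D : ℕ} (hg : ∀ i, (g i).totalDegree ≤ D) (i : Fin (nG + 1)) :
    ((Fin.cons 1 g : Fin (nG + 1) → MvPolynomial (TYW n m) ℝ) i).totalDegree ≤ D := by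
  refine Fin.cases ?_ (fun j => ?_) i
  · simp
  · simpa using hg j

/-- Truncating a moment sequence gives a feasible vector of the relaxation. -/
lemma pRelax_le_of_truncation {d : ℕ} (hd : P.firstOrder g ≤ d) {s : (TYW n m →₀ ℕ) → ℝ}
    (hlin : ∀ α, (P.polyTransport (monomial α 1)).totalDegree ≤ 2 * d → P.LinConstr s α)
    (hpos : ∀ i (q : MvPolynomial (TYW n m) ℝ),
      q.totalDegree ≤ d - halfDeg ((Fin.cons 1 g : Fin (nG + 1) → MvPolynomial (TYW n m) ℝ) i) →
      0 ≤ riesz s ((Fin.cons 1 g : Fin (nG + 1) → MvPolynomial (TYW n m) ℝ) i * q ^ 2)) :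
    P.pRelax g d ≤ ((riesz s P.lHat : ℝ) : EReal) := by
  obtain ⟨h1, -, h3⟩ := firstOrder_spec P g hd
  have hmem : (fun β : MultiIdx (TYW n m) (2 * d) => s β.1) ∈ P.relaxFeasible g d := by
    refine ⟨fun α hα => ?_, fun i => ?_⟩
    · rw [LinConstr, riesz_padZero s hα]
      exact hlin α hα
    · rw [locMatrix_posSemidef_iff]
      intro q hq
      rw [riesz_padZero s (totalDegree_mul_sq_le (totalDegree_cons_le h3 i) hq)]
      exact hpos i q hq
  exact (iInf₂_le _ hmem).trans (le_of_eq (by rw [riesz_padZero s h1]))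

lemma pRelax_le_succ {d : ℕ} (hd : P.firstOrder g ≤ d) : P.pRelax g d ≤ P.pRelax g (d + 1) := by
  refine le_iInf₂ fun z hz => pRelax_le_of_truncation hd (fun α hα => hz.1 α (by omega))
    fun i q hq => locMatrix_posSemidef_iff.1 (hz.2 i) q (by omega)

lemma pRelax_le_pInf {d : ℕ} (hd : P.firstOrder g ≤ d) : P.pRelax g d ≤ P.pInf g :=
  le_iInf₂ fun _ hz => pRelax_le_of_truncation hd (fun α _ => hz.1 α)
    fun i q hq => locMatrix_posSemidef_iff.1 (hz.2 i _) q hq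

lemma isCompact_G (hG : P.G = {x | ∀ i, 0 ≤ eval x (g i)})
    (hball : ∃ i r, g i = C r - ∑ k, X k ^ 2) : IsCompact P.G := by
  obtain ⟨i, r, hi⟩ := hball
  have hclosed : IsClosed P.G := by
    rw [hG, Set.ofPred_forall]
    exact isClosed_iInter fun i => isClosed_le continuous_const (MvPolynomial.continuous_eval _)
  refine (isCompact_univ_pi fun _ : TYW n m => isCompact_Icc (a := -(|r| + 1))
    (b := |r| + 1)).of_isClosed_subset hclosed fun x hx k _ => ?_
  rw [hG] at hx
  have h := hx i
  simp only [hi, map_sub, map_sum, map_pow, eval_C, eval_X] at h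
  have h1 : x k ^ 2 ≤ ∑ k, x k ^ 2 :=
    Finset.single_le_sum (f := fun k => x k ^ 2) (fun _ _ => sq_nonneg _) (Finset.mem_univ k)
  refine abs_le.1 (abs_le_of_sq_le_sq ?_ (by positivity))
  nlinarith [abs_nonneg r, le_abs_self r]

lemma pInf_le_pW (hG : P.G = {x | ∀ i, 0 ≤ eval x (g i)})
    (hball : ∃ i r, g i = C r - ∑ k, X k ^ 2) : P.pInf g ≤ P.pW := by
  refine le_iInf₂ fun γ hγ => ?_
  obtain ⟨hfin, hγG, hv⟩ := hγ
  have hint : ∀ q : MvPolynomial (TYW n m) ℝ, Integrable (fun x => eval x q) γ := fun q =>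
    integrable_of_compact (isCompact_G hG hball) hγG (MvPolynomial.continuous_eval q)
  set L : MvPolynomial (TYW n m) ℝ →ₗ[ℝ] ℝ :=
    { toFun := fun q => ∫ x, eval x q ∂γ
      map_add' := fun p q => by simp only [map_add]; exact integral_add (hint p) (hint q)
      map_smul' := fun c q => by
        simp only [smul_eval, RingHom.id_apply, smul_eq_mul]; exact integral_const_mul _ _ } with hL
  set z : (TYW n m →₀ ℕ) → ℝ := fun α => L (monomial α 1) with hz
  have hr : ∀ q, riesz z q = ∫ x, eval x q ∂γ := riesz_of_linearMap L
  have hae : ∀ᵐ x ∂γ, x ∈ P.G := (measure_eq_zero_iff_ae_notMem.1 hγG).mono fun x hx => not_not.1 hx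
  have hmem : z ∈ P.momentFeasible g := by
    refine ⟨fun α => ?_, fun i d => locMatrix_posSemidef_iff.2 fun q _ => ?_⟩
    · rw [LinConstr, hr]
      simp_rw [eval_polyTransport]
      exact hv _ (contDiff_eval _)
    · rw [hr]
      refine integral_nonneg_of_ae (hae.mono fun x hx => ?_)
      rw [hG] at hx
      simp only [map_mul, map_pow, Pi.zero_apply]
      refine mul_nonneg ?_ (sq_nonneg _)
      refine Fin.cases ?_ (fun j => ?_) i
      · simp
      · simpa using hx j
  exact (iInf₂_le z hmem).trans (le_of_eq (by rw [hr]))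

/-- A moment sequence in the positivity cones of `1` and all `g_i` has a measure on `G`. -/
lemma exists_measure_of_moments (hG : P.G = {x | ∀ i, 0 ≤ eval x (g i)})
    (hball : ∃ i r, g i = C r - ∑ k, X k ^ 2) {z : (TYW n m →₀ ℕ) → ℝ}
    (hz : ∀ i, (Fin.cons 1 g : Fin (nG + 1) → MvPolynomial (TYW n m) ℝ) i ∈
      positivityCone (rieszLin z)) :
    ∃ γ : Measure (TYW n m → ℝ), IsFiniteMeasure γ ∧ γ P.Gᶜ = 0 ∧
      ∀ q, riesz z q = ∫ x, eval x q ∂γ := by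
  rw [hG]
  exact exists_measure_of_positivityCone (L := rieszLin z) (by simpa using hz 0)
    (fun i => by simpa using hz i.succ) hball

/-- The representing measure of an admissible sequence has the same cost, and it is admissible
because polynomial test functions are `C¹`-dense on compact sets. -/
lemma pW_le_pInf (hG : P.G = {x | ∀ i, 0 ≤ eval x (g i)})
    (hball : ∃ i r, g i = C r - ∑ k, X k ^ 2) : P.pW ≤ P.pInf g := by
  refine le_iInf₂ fun z hz => ?_
  obtain ⟨γ, hfin, hγ, hr⟩ := exists_measure_of_moments hG hball fun i =>
    forall_locMatrix_posSemidef_iff.1 (hz.2 i)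
  refine (iInf₂_le γ ⟨hfin, hγ, fun v hv => ?_⟩).trans (le_of_eq (by rw [hr]))
  exact integral_transport_of_linConstr (isCompact_G hG hball) hγ hr hz.1 hv

/-- Coercivity forbids a probability measure on `G` with `∫ w₀^p = 0` and nonpositive cost. -/
lemma cost_pos_of_moments (hG : P.G = {x | ∀ i, 0 ≤ eval x (g i)})
    (hball : ∃ i r, g i = C r - ∑ k, X k ^ 2) {δ : ℝ} (hδ : 0 < δ)
    (hcoer : ∀ x ∈ P.G, δ * (1 - x iW0 ^ P.p) ≤ eval x P.lHat) {z : (TYW n m →₀ ℕ) → ℝ}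
    (hz : ∀ i, (Fin.cons 1 g : Fin (nG + 1) → MvPolynomial (TYW n m) ℝ) i ∈
      positivityCone (rieszLin z)) (hz1 : z 0 = 1) (hw : riesz z (X iW0 ^ P.p) = 0) :
    0 < riesz z P.lHat := by
  obtain ⟨γ, hfin, hγ, hr⟩ := exists_measure_of_moments hG hball hz
  have hae : ∀ᵐ x ∂γ, x ∈ P.G := (measure_eq_zero_iff_ae_notMem.1 hγ).mono fun x hx => not_not.1 hx
  have h1 : riesz z (C δ * (1 - X iW0 ^ P.p)) = δ := by
    have h0 : riesz z (1 : MvPolynomial (TYW n m) ℝ) = 1 := by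
      have := riesz_monomial z 0 1
      simpa [hz1] using this
    rw [← smul_eq_C_mul, ← rieszLin_apply, map_smul, map_sub, rieszLin_apply, rieszLin_apply, h0,
      hw, sub_zero, smul_eq_mul, mul_one]
  have hint : ∀ q : MvPolynomial (TYW n m) ℝ, Integrable (fun x => eval x q) γ := fun q =>
    integrable_of_compact (isCompact_G hG hball) hγ (MvPolynomial.continuous_eval q)
  have h2 : riesz z (C δ * (1 - X iW0 ^ P.p)) ≤ riesz z P.lHat := by
    rw [hr, hr]
    refine integral_mono_ae (hint _) (hint _) (hae.mono fun x hx => ?_)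
    simpa using hcoer x hx
  linarith

/-- The lower semicontinuity step: values of relaxations of arbitrarily high order below `c` force
the value of the moment problem below `c`. -/
lemma pInf_le_of_frequently (hG : P.G = {x | ∀ i, 0 ≤ eval x (g i)})
    (hball : ∃ i r, g i = C r - ∑ k, X k ^ 2) {δ : ℝ} (hδ : 0 < δ)
    (hcoer : ∀ x ∈ P.G, δ * (1 - x iW0 ^ P.p) ≤ eval x P.lHat) {c : ℝ}
    (hc : ∃ᶠ d in atTop, P.pRelax g d < c) : P.pInf g ≤ c := by
  set g' : Fin (nG + 1) → MvPolynomial (TYW n m) ℝ := Fin.cons 1 g with hg'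
  have hone : ∃ i, g' i = 1 := ⟨0, by simp [hg']⟩
  have hball' : ∃ i r, g' i = C r - ∑ k, X k ^ 2 := by
    obtain ⟨i, r, h⟩ := hball
    exact ⟨i.succ, r, by simpa [hg'] using h⟩
  -- An ultrafilter concentrated on the orders with value below `c` replaces diagonal extraction of
  -- subsequences.
  have hne : (atTop ⊓ 𝓟 {d | P.pRelax g d < c}).NeBot := frequently_mem_iff_neBot.1 hc
  set U : Ultrafilter ℕ := Ultrafilter.of (atTop ⊓ 𝓟 {d | P.pRelax g d < c})
  have hUle := Ultrafilter.of_le (atTop ⊓ 𝓟 {d | P.pRelax g d < c})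
  have hU : (U : Filter ℕ) ≤ atTop := hUle.trans inf_le_left
  have hUc : ∀ᶠ d in (U : Filter ℕ), P.pRelax g d < c := hUle (mem_inf_of_right (mem_principal_self _))
  have hge : ∀ k : ℕ, ∀ᶠ d in (U : Filter ℕ), k ≤ d := fun k => hU (eventually_ge_atTop k)
  have hex : ∀ d, ∃ z : MultiIdx (TYW n m) (2 * d) → ℝ, P.pRelax g d < c →
      z ∈ P.relaxFeasible g d ∧ riesz (padZero z) P.lHat < c := by
    intro d
    by_cases h : P.pRelax g d < c
    · obtain ⟨z, hz, hzc⟩ := by simpa only [pRelax, iInf_lt_iff] using h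
      exact ⟨z, fun _ => ⟨hz, by exact_mod_cast hzc⟩⟩
    · exact ⟨0, fun h' => absurd h' h⟩
  choose z hz using hex
  set s : ℕ → (TYW n m →₀ ℕ) → ℝ := fun d => padZero (z d) with hs
  have hpos : ∀ᶠ d in (U : Filter ℕ), ∀ i (q : MvPolynomial (TYW n m) ℝ),
      q.totalDegree ≤ d - halfDeg (g' i) → 0 ≤ riesz (s d) (g' i * q ^ 2) :=
    hUc.mono fun d hd i q hq => locMatrix_posSemidef_iff.1 ((hz d hd).1.2 i) q hq
  have hlin : ∀ α, ∀ᶠ d in (U : Filter ℕ), P.LinConstr (s d) α := fun α => by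
    filter_upwards [hUc, hge (P.polyTransport (monomial α 1)).totalDegree] with d hd h
    exact (hz d hd).1.1 α (by omega)
  have hcost : ∀ᶠ d in (U : Filter ℕ), riesz (s d) P.lHat ≤ c := hUc.mono fun d hd => (hz d hd).2.le
  by_cases hb : ∃ M, ∀ᶠ d in (U : Filter ℕ), s d 0 ≤ M
  · obtain ⟨M, hM⟩ := hb
    obtain ⟨y, hy, hycone⟩ := exists_moment_limit hone hball' hU hpos hM
    have hmem : y ∈ P.momentFeasible g :=
      ⟨fun α => tendsto_nhds_unique (tendsto_riesz hy _)
        (tendsto_const_nhds.congr' ((hlin α).mono fun d hd => hd.symm)),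
        fun i => forall_locMatrix_posSemidef_iff.2 (hycone i)⟩
    exact (iInf₂_le y hmem).trans
      (by exact_mod_cast le_of_tendsto (tendsto_riesz hy _) hcost)
  · exfalso
    -- Along an ultrafilter, failure of every eventual upper bound already means divergence to
    -- infinity.
    have htop : Tendsto (fun d => s d 0) U atTop := by
      refine tendsto_atTop.2 fun M => ?_
      have := Ultrafilter.eventually_not.2 fun h => hb ⟨M, h⟩
      exact this.mono fun d hd => (not_le.1 hd).le
    have hinv : Tendsto (fun d => (s d 0)⁻¹) U (𝓝 0) := tendsto_inv_atTop_zero.comp htop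
    have hgt : ∀ᶠ d in (U : Filter ℕ), 0 < s d 0 := htop.eventually_gt_atTop 0
    obtain ⟨y, hy, hycone⟩ := exists_moment_limit (s := fun d α => (s d 0)⁻¹ * s d α) (M := 1) hone
      hball' hU (by
        filter_upwards [hpos, hgt] with d h1 h2 i q hq
        rw [riesz_smul]
        exact mul_nonneg (inv_pos.2 h2).le (h1 i q hq))
      (hgt.mono fun d hd => (inv_mul_cancel₀ hd.ne').le)
    have hy1 : y 0 = 1 := tendsto_nhds_unique (hy 0)
      (tendsto_const_nhds.congr' (hgt.mono fun d hd => (inv_mul_cancel₀ hd.ne').symm))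
    -- Before scaling this moment is the constant `t_f - t₀`; division by the diverging mass sends
    -- it to zero.
    have hyw : riesz y (X iW0 ^ P.p) = 0 := by
      refine tendsto_nhds_unique (tendsto_riesz hy _) ?_
      have hlim := hinv.mul_const (eval (pointTY P.tf P.yf) (monomial (Finsupp.single iT 1) (1 : ℝ)) -
        eval (pointTY P.t0 P.y0) (monomial (Finsupp.single iT 1) (1 : ℝ)))
      rw [zero_mul] at hlim
      refine hlim.congr' ((hlin (Finsupp.single iT 1)).mono fun d hd => ?_)
      simp only
      rw [riesz_smul, ← polyTransport_time, show riesz (s d) _ = _ from hd]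
    have hyc : riesz y P.lHat ≤ 0 := by
      have hlim := hinv.mul_const c
      rw [zero_mul] at hlim
      refine le_of_tendsto_of_tendsto (tendsto_riesz hy _) hlim ?_
      filter_upwards [hcost, hgt] with d h1 h2
      rw [riesz_smul]
      exact mul_le_mul_of_nonneg_left h1 (inv_pos.2 h2).le
    exact absurd (cost_pos_of_moments hG hball hδ hcoer hycone hy1 hyw) (not_lt.2 hyc)

/-- The upper bound is `pRelax_le_pInf`. If the lower bound failed at some `a < pInf`, a real `c`
strictly between would exceed infinitely many values, contradicting `pInf_le_of_frequently`; this
also covers `pInf = ⊤`. -/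
lemma tendsto_pRelax (hG : P.G = {x | ∀ i, 0 ≤ eval x (g i)})
    (hball : ∃ i r, g i = C r - ∑ k, X k ^ 2) {δ : ℝ} (hδ : 0 < δ)
    (hcoer : ∀ x ∈ P.G, δ * (1 - x iW0 ^ P.p) ≤ eval x P.lHat) :
    Tendsto (fun d => P.pRelax g d) atTop (𝓝 (P.pInf g)) := by
  refine tendsto_order.2 ⟨fun a ha => ?_, fun a ha => ?_⟩
  · by_contra hcon
    obtain ⟨c, hac, hcb⟩ := EReal.lt_iff_exists_real_btwn.1 ha
    refine absurd (pInf_le_of_frequently hG hball hδ hcoer (c := c) ?_) (not_le.2 hcb)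
    exact (not_eventually.1 hcon).mono fun d hd => (not_lt.1 hd).trans_lt hac
  · filter_upwards [eventually_ge_atTop (P.firstOrder g)] with d hd
    exact (pRelax_le_pInf hd).trans_lt ha

end PolyOCP

end MomentOCP

end

theorem mainTheorem2 {n m : ℕ} (P : MomentOCP.PolyOCP n m)
    (hT : P.t0 < P.tf) (hp0 : 0 < P.p) (hp : Even P.p)
    (hl : MomentOCP.CtrlDegreeLE P.p P.l)
    (hf : ∀ i : Fin n, MomentOCP.CtrlDegreeLE P.p (P.f i))
    (δ : ℝ) (hδ : 0 < δ)
    (hcoercive : ∀ t ∈ Set.Icc P.t0 P.tf, ∀ y ∈ P.Y, ∀ u : Fin m → ℝ,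
      δ * ∑ j : Fin m, |u j| ^ P.p ≤ MvPolynomial.eval (MomentOCP.pointTYU t y u) P.l)
    {nG : ℕ} (g : Fin nG → MvPolynomial (MomentOCP.TYW n m) ℝ)
    (hG : P.G = {x | ∀ i : Fin nG, 0 ≤ MvPolynomial.eval x (g i)})
    (hball : ∃ (i : Fin nG) (r : ℝ),
      g i = MvPolynomial.C r - ∑ k : MomentOCP.TYW n m, MvPolynomial.X k ^ 2) :
    (∀ d : ℕ, P.firstOrder g ≤ d → P.pRelax g d ≤ P.pRelax g (d + 1)) ∧
    (∀ d : ℕ, P.firstOrder g ≤ d → P.pRelax g d ≤ P.pInf g) ∧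
    Filter.Tendsto (fun d : ℕ => P.pRelax g d) Filter.atTop (nhds (P.pInf g)) ∧
    P.pInf g = P.pW :=
  ⟨fun _ hd => MomentOCP.PolyOCP.pRelax_le_succ hd,
    fun _ hd => MomentOCP.PolyOCP.pRelax_le_pInf hd,
    MomentOCP.PolyOCP.tendsto_pRelax hG hball hδ fun _ hx =>
      MomentOCP.le_eval_lHat hp hl hcoercive hx,
    le_antisymm (MomentOCP.PolyOCP.pInf_le_pW hG hball) (MomentOCP.PolyOCP.pW_le_pInf hG hball)⟩
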